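/- Let $M$ be a finite-dimensional complex linear subspace of $L^2(\mathbb{R})$ with $\dim M\ge 2$ and $\dim M\neq 5$. Assume that $M$ is closed under the Fourier transform, i.e. $\mathcal{F}f\in M$ for every $f\in M$, where $\mathcal F$ is the unitary extension to $L^2(\mathbb{R})$ of $\mathcal{F}f(\xi)=\int_{\mathbb{R}} f(x)e^{-2\pi i x\xi}\,dx$. Then $M$ does not admit a complete set of translates generated by a single function: there are no $g\in L^2(\mathbb{R})$ and no set $A\subseteq\mathbb{R}$ (finite or infinite) such that $M$ is the closed linear span of $\{g(\cdot-\alpha) : \alpha\in A\}$. -/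

import Mathlib

open MeasureTheory
open scoped FourierTransform ENNReal

noncomputable section

/-- The complex Hilbert space `L²(ℝ)` with respect to Lebesgue measure. -/
abbrev L2R : Type := Lp (α := ℝ) ℂ 2 volume

/-- The translation operator `(T_b f)(x) = f (x - b)` on `L²(ℝ)`. -/
def translateL2 (b : ℝ) (f : L2R) : L2R :=
  Lp.compMeasurePreserving (fun x : ℝ => x - b) (measurePreserving_sub_right volume b) f

theorem translateL2_ae_eq (b : ℝ) (f : L2R) :
    (translateL2 b f : ℝ → ℂ) =ᵐ[volume] fun x => f (x - b) :=
  Lp.coeFn_compMeasurePreserving f (measurePreserving_sub_right volume b)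

/-- The set of translates `{T_α g : α ∈ A}` generated by the single function `g`. -/
def translateSystem (g : L2R) (A : Set ℝ) : Set L2R :=
  (fun α => translateL2 α g) '' A

/-- `M` is closed under the (Plancherel) Fourier transform of `L²(ℝ)`. -/
def ClosedUnderFourier (M : Submodule ℂ L2R) : Prop :=
  ∀ f ∈ M, 𝓕 f ∈ M

/-- `M` admits a complete set of translates generated by a single function: it is the closed
linear span of a set of translates of some `g ∈ L²(ℝ)`. -/
def AdmitsCompleteTranslates (M : Submodule ℂ L2R) : Prop :=
  ∃ (g : L2R) (A : Set ℝ),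
    (Submodule.span ℂ (translateSystem g A)).topologicalClosure = M

end

/-! ### Unimodular characters of the line -/

open Filter Topology


/-! Suppose M is spanned by finitely many translates of g. Since 𝓕 maps M onto itself and turns
translations into modulations, every translate of g in the spanning set is a trigonometric
polynomial times the single function 𝓕 g (`exists_translate_relations`). Eliminating 𝓕 g gives
relations B(x) g(x+δ) = A(x) g(x), with nonzero trigonometric polynomials A, B, for every δ in the
group Δ generated by the differences of the translation parameters.

Let r ≥ 1 be the rank of Δ. After a common character is removed, these trigonometric polynomials are
polynomials in r variables evaluated at exponentials whose frequencies form a basis of Δ;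
translation rescales the variables. Computing g(x+δ₁+δ₂) in two ways gives a cocycle identity in
this factorial ring. Counting prime factors along orbits of the shift by δ₁ (`primeCount_row_eq`,
`exists_coboundary`) shows that A₁/B₁ is a unit times a coboundary times a quotient E₁/E₂ whose
prime factors are all exceptional: modulo multiples of δ₁, each δ₂ in Δ has a nonzero multiple that
fixes the prime up to a unit. Fixing by a shift s forces the frequency differences of the prime into
s⁻¹ℤ.

The contradiction comes from iterating the relation N steps forwards and backwards. Square
integrability makes g(x ± Nδ) tend to 0 for almost every x, so |g(x+Nδ) g(x-Nδ)| / |g(x)|² tends to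
0 where g ≠ 0. The coboundary does not matter along times N at which all characters recur, the
constant factor cancels, and what is left compares products of |E₁/E₂| over N steps with their
shifts by Nδ. If these comparisons are bounded in measure, this is impossible
(`false_of_tight_cocycle`).

Boundedness is a matter of arithmetic. With no resonance, in particular for rank at least three,
exceptional primes have constant modulus (`false_of_nonresonant`). In rank one, and in rank two with
an integral product βδ of nonzero elements of Δ, the relevant primes are one-variable polynomials in
an exponential, and Dirichlet times N make the total angular shift O(1/N). For n points in the
closed disc, an angular shift O(1/n) changes log ∏ |z - ζⱼ| on the unit circle by an amount bounded
in measure: move to radius 1 + 1/n and apply Kolmogorov's inequality to the logarithmic derivative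
(`exists_periodic_majorant`). -/

/-- The character `t ↦ exp (2πit)` of the real line. -/
noncomputable def expi (t : ℝ) : ℂ := Complex.exp ((2 * Real.pi * t : ℝ) * Complex.I)

lemma expi_zero : expi 0 = 1 := by simp [expi]

lemma expi_add (s t : ℝ) : expi (s + t) = expi s * expi t := by
  rw [expi, expi, expi, ← Complex.exp_add]; push_cast; ring_nf

lemma norm_expi (t : ℝ) : ‖expi t‖ = 1 := Complex.norm_exp_ofReal_mul_I _

lemma expi_ne_zero (t : ℝ) : expi t ≠ 0 := Complex.exp_ne_zero _

@[fun_prop]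
lemma continuous_expi : Continuous expi := by unfold expi; fun_prop

lemma expi_neg (t : ℝ) : expi (-t) = (expi t)⁻¹ := by
  refine eq_inv_of_mul_eq_one_left ?_
  rw [← expi_add]; simp [expi_zero]

lemma expi_sub (s t : ℝ) : expi (s - t) = expi s / expi t := by
  rw [sub_eq_add_neg, expi_add, expi_neg]; rfl

lemma expi_sum {ι : Type*} (s : Finset ι) (f : ι → ℝ) :
    expi (∑ i ∈ s, f i) = ∏ i ∈ s, expi (f i) := by
  classical
  induction s using Finset.induction_on with
  | empty => simp [expi_zero]
  | insert a s ha ih => rw [Finset.sum_insert ha, Finset.prod_insert ha, expi_add, ih]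

lemma expi_nat_mul (n : ℕ) (t : ℝ) : expi (n * t) = expi t ^ n := by
  rw [expi, expi, ← Complex.exp_nat_mul]; push_cast; ring_nf

lemma expi_int (n : ℤ) : expi n = 1 := by
  rw [expi, Complex.exp_eq_one_iff]; exact ⟨n, by push_cast; ring⟩

lemma expi_eq_one_iff {t : ℝ} : expi t = 1 ↔ ∃ n : ℤ, t = n := by
  constructor
  · intro h
    rw [expi, Complex.exp_eq_one_iff] at h
    obtain ⟨n, hn⟩ := h
    refine ⟨n, ?_⟩
    have h2 : (t : ℂ) = n := by
      have h3 : (2 * (Real.pi : ℂ) * Complex.I) * (t - n) = 0 := by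
        push_cast at hn; linear_combination hn
      rcases mul_eq_zero.mp h3 with h | h
      · exact absurd h Complex.two_pi_I_ne_zero
      · exact sub_eq_zero.mp h
    exact_mod_cast h2
  · rintro ⟨n, rfl⟩; exact expi_int n

lemma coe_fourierChar (t : ℝ) : ((𝐞 t : Circle) : ℂ) = expi t := by
  rw [Real.fourierChar_apply, expi]

/-! ### Fourier transform, translations and modulations -/

/-- Modulation by the character `ξ ↦ expi (b ξ)`, as a map on `L²(ℝ)`. -/
noncomputable def modulateL2 (b : ℝ) (f : L2R) : L2R :=
  MemLp.toLp (fun x => expi (b * x) * f x)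
    ((Lp.memLp f).of_le (by
      refine AEStronglyMeasurable.mul ?_ (Lp.aestronglyMeasurable f)
      exact Continuous.aestronglyMeasurable (by fun_prop))
      (Eventually.of_forall fun x => by simp [norm_expi]))

lemma modulateL2_ae_eq (b : ℝ) (f : L2R) :
    (modulateL2 b f : ℝ → ℂ) =ᵐ[volume] fun x => expi (b * x) * f x :=
  MemLp.coeFn_toLp _

lemma isometry_modulateL2 (b : ℝ) : Isometry (modulateL2 b) := by
  refine Isometry.of_dist_eq fun f g => ?_
  rw [dist_eq_norm, dist_eq_norm]
  have h : ‖modulateL2 b f - modulateL2 b g‖ = ‖modulateL2 b (f - g)‖ := by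
    congr 1
    apply Lp.ext
    filter_upwards [Lp.coeFn_sub (modulateL2 b f) (modulateL2 b g), modulateL2_ae_eq b f,
      modulateL2_ae_eq b g, modulateL2_ae_eq b (f - g), Lp.coeFn_sub f g] with x h1 h2 h3 h4 h5
    rw [h1, h4, h5, Pi.sub_apply, Pi.sub_apply, h2, h3]; ring
  rw [h, Lp.norm_def, Lp.norm_def]
  congr 1
  refine eLpNorm_congr_norm_ae ?_
  filter_upwards [modulateL2_ae_eq b (f - g)] with x hx
  rw [hx, norm_mul, norm_expi, one_mul]

lemma fourier_translateL2 (b : ℝ) (f : L2R) :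
    𝓕 (translateL2 b f) = modulateL2 (-b) (𝓕 f) := by
  refine DenseRange.induction_on
    (p := fun f : L2R => 𝓕 (translateL2 b f) = modulateL2 (-b) (𝓕 f))
    (SchwartzMap.denseRange_toLpCLM (E := ℝ) (F := ℂ) (μ := volume) (p := 2)
      ENNReal.ofNat_ne_top) f ?_ ?_
  · refine isClosed_eq ?_ ?_
    · exact (Lp.fourierTransformₗᵢ ℝ ℂ).continuous.comp
        (Lp.isometry_compMeasurePreserving _).continuous
    · exact (isometry_modulateL2 _).continuous.comp (Lp.fourierTransformₗᵢ ℝ ℂ).continuous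
  intro φ
  change 𝓕 (translateL2 b (φ.toLp 2)) = modulateL2 (-b) (𝓕 (φ.toLp 2))
  have h1 : translateL2 b (φ.toLp 2) = (φ.compSubConstCLM ℂ b).toLp 2 := by
    apply Lp.ext
    filter_upwards [translateL2_ae_eq b (φ.toLp 2), (φ.compSubConstCLM ℂ b).coeFn_toLp 2 volume,
      (measurePreserving_sub_right volume b).quasiMeasurePreserving.ae_eq_comp
        (φ.coeFn_toLp 2 volume)] with x h1 h2 h3
    rw [h1, h2]
    exact h3
  rw [h1, SchwartzMap.toLp_fourier_eq, SchwartzMap.toLp_fourier_eq]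
  apply Lp.ext
  filter_upwards [(𝓕 (φ.compSubConstCLM ℂ b)).coeFn_toLp 2 volume,
    modulateL2_ae_eq (-b) ((𝓕 φ).toLp 2), (𝓕 φ).coeFn_toLp 2 volume] with x h2 h3 h4
  rw [h2, h3, h4, SchwartzMap.fourier_coe, SchwartzMap.fourier_coe]
  have h5 := congrFun (VectorFourier.fourierIntegral_comp_add_right Real.fourierChar volume
    (innerₗ ℝ) (φ : ℝ → ℂ) (-b)) x
  have h6 : (φ.compSubConstCLM ℂ b : ℝ → ℂ) = (φ : ℝ → ℂ) ∘ fun v => v + -b := by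
    ext v; simp [SchwartzMap.compSubConstCLM_apply, sub_eq_add_neg]
  rw [h6]
  refine h5.trans ?_
  rw [Circle.smul_def, coe_fourierChar, smul_eq_mul]
  congr 2
  simp [mul_comm]

lemma span_translates_eq {M : Submodule ℂ L2R} [FiniteDimensional ℂ M]
    (h : AdmitsCompleteTranslates M) :
    ∃ (g : L2R) (A : Finset ℝ),
      Submodule.span ℂ ((fun α => translateL2 α g) '' (A : Set ℝ)) = M := by
  classical
  obtain ⟨g, A, hA⟩ := h
  have hle : Submodule.span ℂ (translateSystem g A) ≤ M :=
    hA ▸ Submodule.le_topologicalClosure _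
  have : FiniteDimensional ℂ (Submodule.span ℂ (translateSystem g A)) :=
    Submodule.finiteDimensional_of_le hle
  have hspan : Submodule.span ℂ (translateSystem g A) = M := by
    rw [← hA]
    exact (Submodule.closed_of_finiteDimensional _).submodule_topologicalClosure_eq.symm
  have hfg : (Submodule.span ℂ (translateSystem g A)).FG :=
    Module.Finite.iff_fg.mp inferInstance
  obtain ⟨t, ht, hts⟩ := (Submodule.fg_span_iff_fg_span_finset_subset _).mp hfg
  obtain ⟨B, hB, hBt⟩ := Finset.subset_set_image_iff.mp ht
  exact ⟨g, B, by rw [← Finset.coe_image, hBt, ← hts, hspan]⟩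

/-- A Fourier-invariant space spanned by translates of `g` forces every translate of `g` to be a
trigonometric polynomial times one fixed function. -/
theorem exists_translate_relations {M : Submodule ℂ L2R} [FiniteDimensional ℂ M]
    (hdim : 2 ≤ Module.finrank ℂ M) (hM : ClosedUnderFourier M)
    (h : AdmitsCompleteTranslates M) :
    ∃ (g H : ℝ → ℂ) (A : Finset ℝ) (c : ℝ → ℝ → ℂ), MemLp g 2 volume ∧ ¬ g =ᵐ[volume] 0 ∧
      (∃ a ∈ A, ∃ b ∈ A, a ≠ b) ∧
      ∀ a ∈ A, ∀ᵐ x, g (x - a) = (∑ k ∈ A, c a k * expi (-k * x)) * H x := by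
  classical
  obtain ⟨g, A, hA⟩ := span_translates_eq h
  -- An injective operator on a finite-dimensional space is onto, so each translate is the transform
  -- of a combination of translates, that is, a combination of modulations of `𝓕 g`.
  have hsurj : ∀ f ∈ M, ∃ f' ∈ M, 𝓕 f' = f := by
    let T : M →ₗ[ℂ] M := ((Lp.fourierTransformₗᵢ ℝ ℂ).toLinearEquiv.toLinearMap).restrict hM
    have hinj : Function.Injective T := by
      intro x y hxy
      apply Subtype.ext
      exact (Lp.fourierTransformₗᵢ ℝ ℂ).injective (congrArg Subtype.val hxy)
    intro f hf
    obtain ⟨x, hx⟩ := (LinearMap.injective_iff_surjective.mp hinj) ⟨f, hf⟩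
    exact ⟨x.1, x.2, congrArg Subtype.val hx⟩
  have hcoef : ∀ a ∈ A, ∃ d : ℝ → ℂ,
      translateL2 a g = ∑ k ∈ A, d k • modulateL2 (-k) (𝓕 g) := by
    intro a ha
    have hmem : translateL2 a g ∈ M := by
      rw [← hA]; exact Submodule.subset_span (Set.mem_image_of_mem _ (Finset.mem_coe.mpr ha))
    obtain ⟨f, hf, hfa⟩ := hsurj _ hmem
    rw [← hA, Submodule.mem_span_image_finset_iff_exists_fun'] at hf
    obtain ⟨d, hd⟩ := hf
    refine ⟨d, ?_⟩
    rw [← hfa, ← hd]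
    change Lp.fourierTransformₗᵢ ℝ ℂ _ = _
    rw [map_sum]
    refine Finset.sum_congr rfl fun k _ => ?_
    rw [map_smul]
    congr 1
    exact fourier_translateL2 k g
  choose! d hd using hcoef
  refine ⟨g, (𝓕 g : L2R), A, d, Lp.memLp g, ?_, ?_, ?_⟩
  · intro hg
    have hg0 : g = 0 := (Lp.eq_zero_iff_ae_eq_zero).mpr hg
    have : M = ⊥ := by
      rw [← hA, Submodule.span_eq_bot]
      intro x hx
      obtain ⟨a, -, rfl⟩ := hx
      simp [hg0, translateL2]
    rw [this] at hdim
    simp at hdim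
  · by_contra hcon
    push Not at hcon
    have hcard : A.card ≤ 1 := Finset.card_le_one.mpr hcon
    have h1 := finrank_span_finset_le_card (R := ℂ) (A.image fun α => translateL2 α g)
    rw [Set.finrank, Finset.coe_image, hA] at h1
    have h2 := Finset.card_image_le (s := A) (f := fun α => translateL2 α g)
    omega
  · intro a ha
    have h1 : (translateL2 a g : ℝ → ℂ) =ᵐ[volume]
        fun x => ∑ k ∈ A, (d a k • modulateL2 (-k) (𝓕 g) : L2R) x := by
      rw [hd a ha]
      filter_upwards [Lp.coeFn_finsetSum A (fun k => d a k • modulateL2 (-k) (𝓕 g))] with x hx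
      rw [hx]; simp
    have h2 : ∀ᵐ x : ℝ, ∀ k ∈ A, (d a k • modulateL2 (-k) (𝓕 g) : L2R) x
        = d a k * (expi (-k * x) * (𝓕 g : L2R) x) := by
      rw [Filter.eventually_all_finset]
      intro k _
      filter_upwards [Lp.coeFn_smul (d a k) (modulateL2 (-k) (𝓕 g)),
        modulateL2_ae_eq (-k) (𝓕 g)] with x h3 h4
      rw [h3, Pi.smul_apply, h4, smul_eq_mul]
    filter_upwards [h1, h2, translateL2_ae_eq a g] with x h3 h4 h5
    rw [← h5, h3, Finset.sum_mul]
    refine Finset.sum_congr rfl fun k hk => ?_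
    rw [h4 k hk]; ring

/-! ### Prime factors of cocycles in a factorial ring -/

section PrimeCount

open UniqueFactorizationMonoid

variable {R : Type*} [CommRing R]

/-- `q` lies, up to units, in the orbit of `p` under the powers of `σ`. -/
def InRow (σ : MulAut R) (p q : R) : Prop := ∃ k : ℤ, Associated ((σ ^ k) p) q

lemma mulAut_associated (σ : MulAut R) {p q : R} (h : Associated p q) :
    Associated (σ p) (σ q) := h.map σ

lemma mulAut_prime (σ : MulAut R) {p : R} (h : Prime p) : Prime (σ p) :=
  (MulEquiv.prime_iff (e := σ)).mpr h

lemma mulAut_ne_zero (σ : MulAut R) {p : R} (h : p ≠ 0) : σ p ≠ 0 := by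
  intro h0
  exact h (σ.injective (by rw [h0, map_zero]))

lemma InRow.congr {σ : MulAut R} {p q q' : R} (h : Associated q q') :
    InRow σ p q ↔ InRow σ p q' :=
  ⟨fun ⟨k, hk⟩ => ⟨k, hk.trans h⟩, fun ⟨k, hk⟩ => ⟨k, hk.trans h.symm⟩⟩

lemma InRow.self (σ : MulAut R) (p : R) : InRow σ p p := ⟨0, by simp⟩

lemma InRow.apply_iff {σ : MulAut R} {p q : R} : InRow σ p (σ q) ↔ InRow σ p q := by
  constructor
  · rintro ⟨k, hk⟩
    refine ⟨k - 1, ?_⟩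
    have := mulAut_associated σ⁻¹ hk
    rw [show k - 1 = -1 + k by ring, zpow_add, zpow_neg_one]
    simpa using this
  · rintro ⟨k, hk⟩
    refine ⟨1 + k, ?_⟩
    rw [zpow_add, zpow_one]
    exact mulAut_associated σ hk

lemma InRow.symm_iff {σ : MulAut R} {p q q' : R} (h : InRow σ q q') :
    InRow σ p q ↔ InRow σ p q' := by
  obtain ⟨k, hk⟩ := h
  constructor
  · rintro ⟨l, hl⟩
    refine ⟨k + l, ?_⟩
    rw [zpow_add]
    exact (mulAut_associated _ hl).trans hk
  · rintro ⟨l, hl⟩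
    refine ⟨-k + l, ?_⟩
    have h1 := mulAut_associated (σ ^ (-k)) (hl.trans hk.symm)
    rw [zpow_add]
    refine h1.trans ?_
    rw [← MulAut.mul_apply, ← zpow_add]
    simp

open Classical in
lemma countP_eq_of_rel_associated {S : R → Prop}
    (hS : ∀ p q, Associated p q → (S p ↔ S q)) {m m' : Multiset R}
    (h : Multiset.Rel Associated m m') : m.countP S = m'.countP S := by
  induction h with
  | zero => rfl
  | cons hab _ ih =>
    rw [Multiset.countP_cons, Multiset.countP_cons, ih]
    simp only [hS _ _ hab]

lemma associated_of_eq {a b a' b' : R} (h : Associated a b) (ha : a' = a) (hb : b' = b) :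
    Associated a' b' := by rw [ha, hb]; exact h

/-- Telescoping: with L the product, p / σⁿp = L / σL, so replacing a prime by another one of its
orbit costs only a coboundary. -/
lemma prod_range_pow_apply_mul (σ : MulAut R) (p : R) (n : ℕ) :
    (∏ i ∈ Finset.range n, (σ ^ i) p) * (σ ^ n) p = p * σ (∏ i ∈ Finset.range n, (σ ^ i) p) := by
  rw [← Finset.prod_range_succ, Finset.prod_range_succ', map_prod, mul_comm]
  simp only [pow_succ', MulAut.mul_apply, pow_zero, MulAut.one_apply]

variable [IsDomain R] [UniqueFactorizationMonoid R]

open Classical in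
/-- The number of prime factors of `a`, with multiplicity, that satisfy `S`. -/
noncomputable def primeCount (S : R → Prop) (a : R) : ℕ := (factors a).countP S

open Classical in
lemma primeCount_eq_countP {S : R → Prop} (hS : ∀ p q, Associated p q → (S p ↔ S q))
    {m : Multiset R} (hm : ∀ p ∈ m, Prime p) {a : R} (ha : a ≠ 0) (h : Associated m.prod a) :
    primeCount S a = m.countP S :=
  countP_eq_of_rel_associated hS
    (prime_factors_unique (fun p hp => prime_of_factor p hp) hm
      ((factors_prod ha).trans h.symm))

lemma primeCount_mul {S : R → Prop} (hS : ∀ p q, Associated p q → (S p ↔ S q))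
    {a b : R} (ha : a ≠ 0) (hb : b ≠ 0) :
    primeCount S (a * b) = primeCount S a + primeCount S b := by
  classical
  rw [primeCount_eq_countP hS (m := factors a + factors b) ?_ (mul_ne_zero ha hb) ?_,
    Multiset.countP_add]
  · rfl
  · intro p hp
    rcases Multiset.mem_add.mp hp with h | h
    exacts [prime_of_factor p h, prime_of_factor p h]
  · rw [Multiset.prod_add]; exact (factors_prod ha).mul_mul (factors_prod hb)

lemma primeCount_associated {S : R → Prop} (hS : ∀ p q, Associated p q → (S p ↔ S q))
    {a b : R} (ha : a ≠ 0) (h : Associated a b) : primeCount S a = primeCount S b := by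
  classical
  exact (primeCount_eq_countP hS (m := factors b) (fun p hp => prime_of_factor p hp) ha
    ((factors_prod (h.ne_zero_iff.mp ha)).trans h.symm))

lemma primeCount_apply {S : R → Prop} (hS : ∀ p q, Associated p q → (S p ↔ S q))
    (σ : MulAut R) {a : R} (ha : a ≠ 0) :
    primeCount S (σ a) = primeCount (fun p => S (σ p)) a := by
  classical
  rw [primeCount_eq_countP hS (m := (factors a).map σ) ?_ (mulAut_ne_zero σ ha) ?_,
    Multiset.countP_map, primeCount, Multiset.countP_eq_card_filter]
  · intro p hp
    obtain ⟨q, hq, rfl⟩ := Multiset.mem_map.mp hp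
    exact mulAut_prime σ (prime_of_factor q hq)
  · rw [← map_multiset_prod]
    exact mulAut_associated σ (factors_prod ha)

lemma primeCount_of_isUnit {S : R → Prop} (hS : ∀ p q, Associated p q → (S p ↔ S q))
    {a : R} (ha : IsUnit a) : primeCount S a = 0 := by
  classical
  rw [primeCount_eq_countP hS (m := 0) (by simp) ha.ne_zero
    (by simpa using (associated_one_iff_isUnit.mpr ha).symm)]
  simp

lemma primeCount_of_prime {S : R → Prop} [DecidablePred S]
    (hS : ∀ p q, Associated p q → (S p ↔ S q))
    {p : R} (hp : Prime p) : primeCount S p = if S p then 1 else 0 := by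
  classical
  rw [primeCount_eq_countP hS (m := {p}) (by simpa using hp) hp.ne_zero (by simp)]
  simp [Multiset.countP_cons, ← Multiset.cons_zero]

/-- The prime factors of a cocycle for two commuting automorphisms balance out along every row
whose translates under the second automorphism are pairwise distinct. -/
lemma primeCount_row_eq {σ₁ σ₂ : MulAut R} (hcomm : Commute σ₁ σ₂) {A₁ B₁ A₂ B₂ : R}
    (hA₁ : A₁ ≠ 0) (hB₁ : B₁ ≠ 0) (hA₂ : A₂ ≠ 0) (hB₂ : B₂ ≠ 0)
    (hid : Associated (σ₁ A₂ * A₁ * (σ₂ B₁ * B₂)) (σ₂ A₁ * A₂ * (σ₁ B₂ * B₁)))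
    {p : R} (hp : ∀ m : ℤ, m ≠ 0 → ∀ k : ℤ, ¬ Associated ((σ₂ ^ m * σ₁ ^ k) p) p) :
    primeCount (InRow σ₁ p) A₁ = primeCount (InRow σ₁ p) B₁ := by
  classical
  have hS : ∀ m : ℤ, ∀ q q', Associated q q' →
      (InRow σ₁ ((σ₂ ^ m) p) q ↔ InRow σ₁ ((σ₂ ^ m) p) q') := fun m q q' h => InRow.congr h
  have hstep : ∀ (m : ℤ) (a : R), a ≠ 0 → primeCount (InRow σ₁ ((σ₂ ^ (m + 1)) p)) (σ₂ a)
      = primeCount (InRow σ₁ ((σ₂ ^ m) p)) a := by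
    intro m a ha
    rw [primeCount_apply (hS _) σ₂ ha]
    congr 1
    funext q
    refine propext ⟨?_, ?_⟩
    · rintro ⟨k, hk⟩
      refine ⟨k, ?_⟩
      have h1 : Associated ((σ₂⁻¹ * (σ₁ ^ k * σ₂ ^ (m + 1))) p) ((σ₂⁻¹ * σ₂) q) :=
        mulAut_associated σ₂⁻¹ hk
      have h2 : σ₂⁻¹ * (σ₁ ^ k * σ₂ ^ (m + 1)) = σ₁ ^ k * σ₂ ^ m := by
        rw [← mul_assoc, ((hcomm.zpow_left k).inv_right).symm.eq, mul_assoc, zpow_add, zpow_one,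
          (Commute.zpow_self σ₂ m).eq]
        group
      rw [h2] at h1
      simpa using h1
    · rintro ⟨k, hk⟩
      refine ⟨k, ?_⟩
      have h1 : Associated ((σ₂ * (σ₁ ^ k * σ₂ ^ m)) p) (σ₂ q) := mulAut_associated σ₂ hk
      have h2 : σ₂ * (σ₁ ^ k * σ₂ ^ m) = σ₁ ^ k * σ₂ ^ (m + 1) := by
        rw [← mul_assoc, (hcomm.zpow_left k).symm.eq, mul_assoc, zpow_add, zpow_one,
          (Commute.zpow_self σ₂ m).eq]
      rw [h2] at h1
      exact h1
  have hσ₁ : ∀ (m : ℤ) (a : R), a ≠ 0 → primeCount (InRow σ₁ ((σ₂ ^ m) p)) (σ₁ a)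
      = primeCount (InRow σ₁ ((σ₂ ^ m) p)) a := by
    intro m a ha
    rw [primeCount_apply (hS _) σ₁ ha]
    congr 1
    funext q
    exact propext InRow.apply_iff
  -- Count the primes of `hid` in row m + 1. Since σ₁ preserves rows, A₂ and B₂ cancel; since σ₂
  -- moves row m to row m + 1, the excess of A₁ over B₁ is the same in both rows.
  have hrec : ∀ m : ℤ, primeCount (InRow σ₁ ((σ₂ ^ (m + 1)) p)) A₁
        + primeCount (InRow σ₁ ((σ₂ ^ m) p)) B₁
      = primeCount (InRow σ₁ ((σ₂ ^ m) p)) A₁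
        + primeCount (InRow σ₁ ((σ₂ ^ (m + 1)) p)) B₁ := by
    intro m
    have hn1 := fun {a : R} (ha : a ≠ 0) => mulAut_ne_zero σ₁ ha
    have hn2 := fun {a : R} (ha : a ≠ 0) => mulAut_ne_zero σ₂ ha
    have h := primeCount_associated (hS (m + 1)) (by
      simp [hA₁, hB₁, hA₂, hB₂]) hid
    rw [primeCount_mul (hS _) (mul_ne_zero (hn1 hA₂) hA₁) (mul_ne_zero (hn2 hB₁) hB₂),
      primeCount_mul (hS _) (hn1 hA₂) hA₁, primeCount_mul (hS _) (hn2 hB₁) hB₂,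
      primeCount_mul (hS _) (mul_ne_zero (hn2 hA₁) hA₂) (mul_ne_zero (hn1 hB₂) hB₁),
      primeCount_mul (hS _) (hn2 hA₁) hA₂, primeCount_mul (hS _) (hn1 hB₂) hB₁,
      hstep m A₁ hA₁, hstep m B₁ hB₁, hσ₁ _ _ hA₂, hσ₁ _ _ hB₂] at h
    omega
  have hall : ∀ n : ℕ, (primeCount (InRow σ₁ p) A₁ : ℤ) - primeCount (InRow σ₁ p) B₁
      = primeCount (InRow σ₁ ((σ₂ ^ (n : ℤ)) p)) A₁
        - primeCount (InRow σ₁ ((σ₂ ^ (n : ℤ)) p)) B₁ := by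
    intro n
    induction n with
    | zero => simp
    | succ n ih =>
      rw [ih]
      have := hrec n
      push_cast
      omega
  -- A₁ and B₁ have finitely many prime factors and the rows are pairwise distinct, so some row
  -- misses all of them; there the constant excess is 0.
  obtain ⟨n, hn⟩ : ∃ n : ℕ, ∀ q ∈ factors A₁ + factors B₁,
      ¬ InRow σ₁ ((σ₂ ^ (n : ℤ)) p) q := by
    by_contra hcon
    push Not at hcon
    choose q hq hrow using hcon
    obtain ⟨i, j, hij, hqij⟩ := Finite.exists_ne_map_eq_of_infinite
      (fun n : ℕ => (⟨q n, Multiset.mem_toFinset.mpr (hq n)⟩ :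
        (factors A₁ + factors B₁).toFinset))
    have hqq : q i = q j := congrArg Subtype.val hqij
    obtain ⟨k, hk⟩ := hrow i
    obtain ⟨l, hl⟩ := hrow j
    rw [hqq] at hk
    have h1 : Associated ((σ₁ ^ (-l) * σ₂ ^ (-(j : ℤ)) * (σ₁ ^ k * σ₂ ^ (i : ℤ))) p)
        ((σ₁ ^ (-l) * σ₂ ^ (-(j : ℤ)) * (σ₁ ^ l * σ₂ ^ (j : ℤ))) p) :=
      mulAut_associated (σ₁ ^ (-l) * σ₂ ^ (-(j : ℤ))) (hk.trans hl.symm)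
    have e1 : σ₁ ^ (-l) * σ₂ ^ (-(j : ℤ)) * (σ₁ ^ k * σ₂ ^ (i : ℤ))
        = σ₂ ^ ((i : ℤ) - j) * σ₁ ^ (k - l) := by
      have c := fun a b : ℤ => ((hcomm.zpow_left a).zpow_right b).eq
      rw [sub_eq_neg_add, sub_eq_add_neg, zpow_add, zpow_add]
      calc _ = σ₁ ^ (-l) * (σ₂ ^ (-(j : ℤ)) * (σ₁ ^ k * σ₂ ^ (i : ℤ))) := mul_assoc _ _ _
        _ = σ₁ ^ (-l) * (σ₂ ^ (-(j : ℤ)) * (σ₂ ^ (i : ℤ) * σ₁ ^ k)) := by rw [c k i]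
        _ = σ₁ ^ (-l) * (σ₂ ^ (-(j : ℤ) + i) * σ₁ ^ k) := by rw [zpow_add, mul_assoc]
        _ = σ₂ ^ (-(j : ℤ) + i) * σ₁ ^ (-l) * σ₁ ^ k := by rw [← mul_assoc, c]
        _ = _ := by rw [mul_assoc, ← zpow_add, add_comm (-l) k, zpow_add, zpow_add]
    have e2 : σ₁ ^ (-l) * σ₂ ^ (-(j : ℤ)) * (σ₁ ^ l * σ₂ ^ (j : ℤ)) = 1 := by
      have c := fun a b : ℤ => ((hcomm.zpow_left a).zpow_right b).eq
      rw [c l j]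
      group
    rw [e1, e2] at h1
    exact hp ((i : ℤ) - j) (sub_ne_zero.mpr (by exact_mod_cast hij)) (k - l) (by simpa using h1)
  have hzero : ∀ a : R, (∀ q ∈ factors a, ¬ InRow σ₁ ((σ₂ ^ (n : ℤ)) p) q) →
      primeCount (InRow σ₁ ((σ₂ ^ (n : ℤ)) p)) a = 0 := by
    intro a ha
    rw [primeCount, Multiset.countP_eq_zero]
    exact ha
  have h0 := hall n
  rw [hzero A₁ fun q hq => hn q (Multiset.mem_add.mpr (Or.inl hq)),
    hzero B₁ fun q hq => hn q (Multiset.mem_add.mpr (Or.inr hq))] at h0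
  omega

/-- If the prime factors of `A` and `B` balance along the rows of all primes outside `E`, then
`A / B` is a coboundary up to a unit and primes in `E`. -/
lemma exists_coboundary {σ : MulAut R} {E : R → Prop}
    (hE : ∀ p q, InRow σ p q → (E p ↔ E q)) :
    ∀ {A : R}, A ≠ 0 → ∀ {B : R}, B ≠ 0 →
    (∀ p, Prime p → ¬ E p → primeCount (InRow σ p) A = primeCount (InRow σ p) B) →
    ∃ H K E₁ E₂ : R, H ≠ 0 ∧ K ≠ 0 ∧ E₁ ≠ 0 ∧ E₂ ≠ 0 ∧
      (∀ p, Prime p → p ∣ E₁ → E p) ∧ (∀ p, Prime p → p ∣ E₂ → E p) ∧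
      Associated (A * E₂ * H * σ K) (B * E₁ * σ H * K) := by
  classical
  have hrow : ∀ p : R, ∀ q q', Associated q q' → (InRow σ p q ↔ InRow σ p q') :=
    fun p q q' h => InRow.congr h
  intro A
  refine UniqueFactorizationMonoid.induction_on_prime
    (P := fun A => A ≠ 0 → ∀ {B : R}, B ≠ 0 →
    (∀ p, Prime p → ¬ E p → primeCount (InRow σ p) A = primeCount (InRow σ p) B) →
    ∃ H K E₁ E₂ : R, H ≠ 0 ∧ K ≠ 0 ∧ E₁ ≠ 0 ∧ E₂ ≠ 0 ∧
      (∀ p, Prime p → p ∣ E₁ → E p) ∧ (∀ p, Prime p → p ∣ E₂ → E p) ∧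
      Associated (A * E₂ * H * σ K) (B * E₁ * σ H * K)) A (fun h => absurd rfl h) ?_ ?_
  · intro u hu _ B hB hbal
    -- A unit has no prime factors, so balance forces every prime of B to lie in E and B itself can
    -- serve as E₂.
    refine ⟨1, 1, 1, B, one_ne_zero, one_ne_zero, one_ne_zero, hB, ?_, ?_, ?_⟩
    · intro p hp h; exact absurd (isUnit_of_dvd_one h) hp.not_isUnit
    · intro p hp hpB
      by_contra hpE
      obtain ⟨B', rfl⟩ := hpB
      have h := hbal p hp hpE
      rw [primeCount_of_isUnit (hrow p) hu,
        primeCount_mul (hrow p) hp.ne_zero (right_ne_zero_of_mul hB),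
        primeCount_of_prime (hrow p) hp, if_pos (InRow.self σ p)] at h
      omega
    · simp only [map_one, mul_one]
      exact associated_unit_mul_left _ _ hu
  · intro A' p hA' hp ih _ B hB hbal
    by_cases hpE : E p
    · obtain ⟨H, K, E₁, E₂, hH, hK, hE₁, hE₂, hd₁, hd₂, hass⟩ := ih hA' hB (by
        intro q hq hqE
        have h := hbal q hq hqE
        rw [primeCount_mul (hrow q) hp.ne_zero hA', primeCount_of_prime (hrow q) hp,
          if_neg fun hr => hqE ((hE q p hr).mpr hpE), zero_add] at h
        exact h)
      refine ⟨H, K, E₁ * p, E₂, hH, hK, mul_ne_zero hE₁ hp.ne_zero, hE₂, ?_, hd₂, ?_⟩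
      · intro q hq hqd
        rcases hq.dvd_or_dvd hqd with h | h
        · exact hd₁ q hq h
        · exact (hE q p ⟨0, by simpa using (hq.dvd_prime_iff_associated hp).mp h⟩).mpr hpE
      · have h := (Associated.refl p).mul_mul hass
        exact associated_of_eq h (by ring) (by ring)
    -- Balance supplies a prime q of B in the row of p. Cancelling p against q leaves a quotient p /
    -- σᵏp, absorbed into K or H according to the sign of k.
    · obtain ⟨q, hqB, hrowq⟩ : ∃ q ∈ factors B, InRow σ p q := by
        have h := hbal p hp hpE
        rw [primeCount_mul (hrow p) hp.ne_zero hA', primeCount_of_prime (hrow p) hp,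
          if_pos (InRow.self σ p)] at h
        have h2 : 0 < (factors B).countP (InRow σ p) := by
          have : primeCount (InRow σ p) B = (factors B).countP (InRow σ p) := by
            unfold primeCount; congr
          omega
        simpa using Multiset.countP_pos.mp h2
      have hqp : Prime q := prime_of_factor q hqB
      obtain ⟨B', hB'⟩ : q ∣ B := dvd_of_mem_factors hqB
      have hB'0 : B' ≠ 0 := by rintro rfl; exact hB (by rw [hB', mul_zero])
      obtain ⟨H, K, E₁, E₂, hH, hK, hE₁, hE₂, hd₁, hd₂, hass⟩ := ih hA' hB'0 (by
        intro π hπ hπE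
        have h := hbal π hπ hπE
        rw [hB', primeCount_mul (hrow π) hp.ne_zero hA', primeCount_of_prime (hrow π) hp,
          primeCount_mul (hrow π) hqp.ne_zero hB'0, primeCount_of_prime (hrow π) hqp] at h
        simp only [InRow.symm_iff hrowq (p := π)] at h
        omega)
      obtain ⟨k, hk⟩ := hrowq
      have key : Associated (A' * E₂ * H * σ K * p * (σ ^ k) p)
          (B * E₁ * σ H * K * p) := by
        have h := (hass.mul_mul (Associated.refl p)).mul_mul hk
        rw [hB']
        exact associated_of_eq h (by ring) (by ring)
      obtain ⟨n, rfl | rfl⟩ := k.eq_nat_or_neg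
      · set L := ∏ i ∈ Finset.range n, (σ ^ i) p with hL
        have hL0 : L ≠ 0 := Finset.prod_ne_zero_iff.mpr fun i _ =>
          mulAut_ne_zero _ hp.ne_zero
        refine ⟨H, K * L, E₁, E₂, hH, mul_ne_zero hK hL0, hE₁, hE₂, hd₁, hd₂, ?_⟩
        have h := key.mul_mul (Associated.refl L)
        have hLp := prod_range_pow_apply_mul σ p n
        rw [← hL] at hLp
        rw [zpow_natCast] at h
        refine Associated.of_mul_right (b := p) (d := p) ?_ (Associated.refl p) hp.ne_zero
        refine associated_of_eq h ?_ (by ring)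
        rw [map_mul]
        linear_combination (-A' * E₂ * H * σ K * p) * hLp
      · set q0 := (σ ^ (-(n : ℤ))) p with hq0
        have hpq : (σ ^ n) q0 = p := by
          rw [hq0, ← MulAut.mul_apply, ← zpow_natCast, ← zpow_add]; simp
        have hq00 : q0 ≠ 0 := mulAut_ne_zero _ hp.ne_zero
        set L := ∏ i ∈ Finset.range n, (σ ^ i) q0 with hL
        have hL0 : L ≠ 0 := Finset.prod_ne_zero_iff.mpr fun i _ =>
          mulAut_ne_zero _ hq00
        refine ⟨H * L, K, E₁, E₂, mul_ne_zero hH hL0, hK, hE₁, hE₂, hd₁, hd₂, ?_⟩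
        have hLp := prod_range_pow_apply_mul σ q0 n
        rw [← hL, hpq] at hLp
        have h := key.mul_mul (Associated.refl (σ L))
        refine Associated.of_mul_right (b := p) (d := p) ?_ (Associated.refl p) hp.ne_zero
        refine associated_of_eq h ?_ ?_
        · linear_combination (A' * E₂ * H * σ K * p) * hLp
        · rw [map_mul]; ring

end PrimeCount

/-! ### Logarithms and Cauchy kernels on circles -/

section CircleEstimates

lemma circleMap_two_pi_mul (r θ : ℝ) : circleMap 0 r (2 * Real.pi * θ) = r * expi θ := by
  simp [circleMap, expi]

lemma expi_periodic : Function.Periodic expi 1 := by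
  intro θ
  have : expi 1 = 1 := by simpa using expi_int 1
  rw [expi_add, this, mul_one]

lemma integral_comp_expi (F : ℂ → ℝ) (r : ℝ) :
    ∫ θ in (0 : ℝ)..1, F (r * expi θ) = Real.circleAverage F 0 r := by
  have h := intervalIntegral.integral_comp_mul_left (a := 0) (b := 1)
    (fun t => F (circleMap 0 r t)) Real.two_pi_pos.ne'
  simp only [circleMap_two_pi_mul, mul_zero, mul_one] at h
  rw [h, Real.circleAverage_def]

lemma intervalIntegrable_comp_expi {F : ℂ → ℝ} {r : ℝ} (hF : CircleIntegrable F 0 r) :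
    IntervalIntegrable (fun θ => F (r * expi θ)) volume 0 1 := by
  have h := IntervalIntegrable.comp_mul_left (c := 2 * Real.pi) hF
  simpa [circleMap_two_pi_mul, Real.pi_ne_zero] using h

/-- The growth of `log ‖z - ζ‖` from the unit circle to the circle of radius `r`. -/
noncomputable def logGap (r : ℝ) (ζ : ℂ) (θ : ℝ) : ℝ :=
  Real.log ‖r * expi θ - ζ‖ - Real.log ‖expi θ - ζ‖

lemma logGap_nonneg {r : ℝ} (hr : 1 ≤ r) {ζ : ℂ} (hζ : ‖ζ‖ ≤ 1) {θ : ℝ} (h : expi θ ≠ ζ) :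
    0 ≤ logGap r ζ θ := by
  have hpos : 0 < ‖expi θ - ζ‖ := norm_pos_iff.mpr (sub_ne_zero.mpr h)
  refine sub_nonneg.mpr (Real.log_le_log hpos ?_)
  set z := expi θ with hz
  have hz1 : z.re * z.re + z.im * z.im = 1 := by
    rw [← Complex.normSq_apply, Complex.normSq_eq_norm_sq, hz, norm_expi, one_pow]
  have hζ1 : ζ.re * ζ.re + ζ.im * ζ.im ≤ 1 := by
    rw [← Complex.normSq_apply, Complex.normSq_eq_norm_sq]
    exact pow_le_one₀ (norm_nonneg _) hζ
  rw [← abs_of_nonneg (norm_nonneg (z - ζ)), ← abs_of_nonneg (norm_nonneg ((r : ℂ) * z - ζ)),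
    ← sq_le_sq, ← Complex.normSq_eq_norm_sq, ← Complex.normSq_eq_norm_sq, Complex.normSq_apply,
    Complex.normSq_apply]
  simp only [Complex.sub_re, Complex.sub_im, Complex.mul_re, Complex.mul_im, Complex.ofReal_re,
    Complex.ofReal_im, zero_mul, sub_zero, add_zero]
  have hin : z.re * ζ.re + z.im * ζ.im ≤ 1 := by
    nlinarith [sq_nonneg (z.re - ζ.re), sq_nonneg (z.im - ζ.im)]
  have e : (r * z.re - ζ.re) * (r * z.re - ζ.re) + (r * z.im - ζ.im) * (r * z.im - ζ.im)
      - ((z.re - ζ.re) * (z.re - ζ.re) + (z.im - ζ.im) * (z.im - ζ.im))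
      = (r - 1) * ((r + 1) * (z.re * z.re + z.im * z.im)
        - 2 * (z.re * ζ.re + z.im * ζ.im)) := by ring
  have : 0 ≤ (r - 1) * ((r + 1) * (z.re * z.re + z.im * z.im)
        - 2 * (z.re * ζ.re + z.im * ζ.im)) := by
    refine mul_nonneg (by linarith) ?_
    rw [hz1]; linarith
  linarith

lemma intervalIntegrable_logGap (r : ℝ) (ζ : ℂ) :
    IntervalIntegrable (logGap r ζ) volume 0 1 := by
  have h1 := intervalIntegrable_comp_expi (F := fun z => Real.log ‖z - ζ‖)
    (circleIntegrable_log_norm_sub_const (a := ζ) (c := 0) r)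
  have h2 := intervalIntegrable_comp_expi (F := fun z => Real.log ‖z - ζ‖)
    (circleIntegrable_log_norm_sub_const (a := ζ) (c := 0) 1)
  simp only [Complex.ofReal_one, one_mul] at h2
  exact h1.sub h2

/-- By Jensen's formula the mean of log |z - ζ| over a circle whose closed disc contains ζ is the
logarithm of the radius. -/
lemma integral_logGap {r : ℝ} (hr : 1 ≤ r) {ζ : ℂ} (hζ : ‖ζ‖ ≤ 1) :
    ∫ θ in (0 : ℝ)..1, logGap r ζ θ = Real.log r := by
  have h1 := intervalIntegrable_comp_expi (F := fun z => Real.log ‖z - ζ‖)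
    (circleIntegrable_log_norm_sub_const (a := ζ) (c := 0) r)
  have h2 := intervalIntegrable_comp_expi (F := fun z => Real.log ‖z - ζ‖)
    (circleIntegrable_log_norm_sub_const (a := ζ) (c := 0) 1)
  have e1 := integral_comp_expi (fun z => Real.log ‖z - ζ‖) r
  have e2 := integral_comp_expi (fun z => Real.log ‖z - ζ‖) 1
  rw [circleAverage_log_norm_sub_const_of_mem_closedBall (by
    rw [mem_closedBall_zero_iff, abs_of_nonneg (by linarith)]; linarith)] at e1
  rw [circleAverage_log_norm_sub_const_of_mem_closedBall (by
    rw [mem_closedBall_zero_iff, abs_one]; exact hζ), Real.log_one] at e2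
  simp only [Complex.ofReal_one, one_mul] at h2 e2
  have h3 := intervalIntegral.integral_sub h1 h2
  rw [e1, e2, sub_zero] at h3
  exact h3

lemma logGap_periodic (r : ℝ) (ζ : ℂ) : Function.Periodic (logGap r ζ) 1 := by
  intro θ
  simp only [logGap, expi_periodic θ]

/-- The principal root of a number in the right half-plane has argument at most π/4 in absolute
value. -/
lemma sqrt_norm_le_re_cpow {z : ℂ} (hz : 0 < z.re) :
    √‖z‖ ≤ √2 * (z ^ (1 / 2 : ℂ)).re := by
  have hz0 : z ≠ 0 := by rintro rfl; simp at hz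
  set s := z ^ (1 / 2 : ℂ) with hs
  have hss : s * s = z := by
    rw [hs, ← Complex.cpow_add _ _ hz0]; norm_num
  have hre : 0 ≤ s.re := by
    rw [hs, Complex.cpow_def_of_ne_zero hz0, Complex.exp_re]
    refine mul_nonneg (Real.exp_pos _).le (Real.cos_nonneg_of_mem_Icc ?_)
    have him : (Complex.log z * (1 / 2)).im = z.arg / 2 := by
      rw [show (1 / 2 : ℂ) = ((1 / 2 : ℝ) : ℂ) by push_cast; rfl, Complex.im_mul_ofReal,
        Complex.log_im]; ring
    rw [him]
    have h1 := Complex.neg_pi_lt_arg z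
    have h2 := Complex.arg_le_pi z
    exact ⟨by linarith, by linarith⟩
  have h1 : z.re = s.re * s.re - s.im * s.im := by rw [← hss, Complex.mul_re]
  have h2 : ‖z‖ = s.re * s.re + s.im * s.im := by
    rw [← hss, norm_mul, ← sq, ← Complex.normSq_eq_norm_sq, Complex.normSq_apply]
  rw [← Real.sqrt_sq hre, ← Real.sqrt_mul (by norm_num)]
  refine Real.sqrt_le_sqrt ?_
  rw [h2]; nlinarith

lemma re_inv_pos {z : ℂ} (hz : 0 < z.re) : 0 < z⁻¹.re := by
  have hz0 : z ≠ 0 := by rintro rfl; simp at hz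
  rw [Complex.inv_re]
  exact div_pos hz (Complex.normSq_pos.mpr hz0)

/-- Kolmogorov's inequality for a sum of Cauchy kernels. -/
lemma integral_sqrt_norm_sum_le {n : ℕ} (hn : 0 < n) {ζ : ℕ → ℂ} (hζ : ∀ j, ‖ζ j‖ ≤ 1) {ρ : ℝ}
    (hρ0 : 0 < ρ) (hρ : ρ < 1) :
    ∫ θ in (0 : ℝ)..1, √(‖(∑ j ∈ Finset.range n, (1 - ζ j * (ρ * expi θ))⁻¹) / n‖) ≤ √2 := by
  set h : ℂ → ℂ := fun w => (∑ j ∈ Finset.range n, (1 - ζ j * w)⁻¹) / n with hh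
  have hn' : (0 : ℝ) < n := by exact_mod_cast hn
  have hre1 : ∀ w : ℂ, ‖w‖ < 1 → ∀ j, 0 < (1 - ζ j * w).re := by
    intro w hw j
    have h1 : (ζ j * w).re ≤ ‖ζ j * w‖ := Complex.re_le_norm _
    have h2 : ‖ζ j * w‖ < 1 := by
      rw [norm_mul]
      calc ‖ζ j‖ * ‖w‖ ≤ 1 * ‖w‖ := by gcongr; exact hζ j
        _ < 1 := by linarith
    simp only [Complex.sub_re, Complex.one_re]; linarith
  have hne : ∀ w : ℂ, ‖w‖ < 1 → ∀ j, 1 - ζ j * w ≠ 0 := by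
    intro w hw j h0
    have := hre1 w hw j
    rw [h0] at this; simp at this
  have hre : ∀ w : ℂ, ‖w‖ < 1 → 0 < (h w).re := by
    intro w hw
    rw [hh]
    simp only
    rw [show (n : ℂ) = ((n : ℝ) : ℂ) by simp, Complex.div_ofReal_re, Complex.re_sum]
    refine div_pos (Finset.sum_pos (fun j _ => re_inv_pos (hre1 w hw j)) ?_) hn'
    exact ⟨0, Finset.mem_range.mpr hn⟩
  have hdiff : DifferentiableOn ℂ (fun w => h w ^ (1 / 2 : ℂ)) (Metric.ball 0 1) := by
    intro w hw
    have hw1 : ‖w‖ < 1 := by simpa using hw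
    refine DifferentiableAt.differentiableWithinAt ?_
    refine DifferentiableAt.cpow ?_ (differentiableAt_const _) (Or.inl (hre w hw1))
    refine DifferentiableAt.div_const (DifferentiableAt.fun_sum fun j _ => ?_) _
    exact DifferentiableAt.inv (by fun_prop) (hne w hw1 j)
  have hsub : Metric.closedBall (0 : ℂ) |ρ| ⊆ Metric.ball 0 1 :=
    Metric.closedBall_subset_ball (by rw [abs_of_pos hρ0]; exact hρ)
  have hDC : DiffContOnCl ℂ (fun w => h w ^ (1 / 2 : ℂ)) (Metric.ball 0 |ρ|) :=
    (hdiff.mono (Metric.closure_ball_subset_closedBall.trans hsub)).diffContOnCl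
  have hcont : ContinuousOn (fun w => h w ^ (1 / 2 : ℂ)) (Metric.sphere 0 |ρ|) :=
    hdiff.continuousOn.mono (Metric.sphere_subset_closedBall.trans hsub)
  have hcont' : ContinuousOn h (Metric.sphere 0 |ρ|) := by
    intro w hw
    have hw1 : ‖w‖ < 1 := by simpa using hsub (Metric.sphere_subset_closedBall hw)
    refine ContinuousAt.continuousWithinAt ?_
    refine ContinuousAt.div_const (tendsto_finsetSum _ fun j _ => ?_) _
    exact ContinuousAt.inv₀ (by fun_prop) (hne w hw1 j)
  have hint : CircleIntegrable (fun w => h w ^ (1 / 2 : ℂ)) 0 ρ := by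
    refine ContinuousOn.circleIntegrable' hcont
  have havg := hDC.circleAverage
  have h0 : h 0 = 1 := by
    rw [hh]; simp [hn.ne']
  simp only [h0, Complex.one_cpow] at havg
  have hreavg : Real.circleAverage (fun w => (h w ^ (1 / 2 : ℂ)).re) 0 ρ = 1 := by
    have := Complex.reCLM.circleAverage_comp_comm hint
    rw [havg] at this
    exact this.trans (by simp)
  have hreint : CircleIntegrable (fun w => (h w ^ (1 / 2 : ℂ)).re) 0 ρ :=
    ContinuousOn.circleIntegrable' (Complex.continuous_re.comp_continuousOn hcont)
  have hsqint : CircleIntegrable (fun w => √(‖h w‖)) 0 ρ :=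
    ContinuousOn.circleIntegrable' (Real.continuous_sqrt.comp_continuousOn hcont'.norm)
  -- The average h of the kernels has positive real part in the disc, so h^(1/2) is holomorphic
  -- there and √|h| ≤ √2 Re h^(1/2); the mean of the right side is √2, as h(0) = 1.
  have hmain : ∫ θ in (0 : ℝ)..1, √‖h (ρ * expi θ)‖
      ≤ ∫ θ in (0 : ℝ)..1, √2 * (h (ρ * expi θ) ^ (1 / 2 : ℂ)).re := by
    refine intervalIntegral.integral_mono_on zero_le_one (intervalIntegrable_comp_expi hsqint)
      ((intervalIntegrable_comp_expi hreint).const_mul _) fun θ _ => ?_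
    refine sqrt_norm_le_re_cpow (hre _ ?_)
    rw [norm_mul, norm_expi, mul_one, Complex.norm_real, Real.norm_eq_abs, abs_of_pos hρ0]
    exact hρ
  refine hmain.trans (le_of_eq ?_)
  rw [intervalIntegral.integral_const_mul,
    integral_comp_expi (fun w => (h w ^ (1 / 2 : ℂ)).re) ρ, hreavg, mul_one]

lemma hasDerivAt_log_norm {F : ℝ → ℂ} {F' : ℂ} {t : ℝ} (h : HasDerivAt F F' t) (h0 : F t ≠ 0) :
    HasDerivAt (fun s => Real.log ‖F s‖) (F' / F t).re t := by
  have hsq := (h.norm_sq).log (pow_ne_zero 2 (norm_ne_zero_iff.mpr h0))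
  have h2 := hsq.const_mul (1 / 2 : ℝ)
  have e : (fun s => Real.log ‖F s‖) = fun s => 1 / 2 * Real.log (‖F s‖ ^ 2) := by
    funext s; rw [Real.log_pow]; push_cast; ring
  rw [e]
  refine h2.congr_deriv ?_
  rw [Complex.div_re, Complex.inner, ← Complex.normSq_eq_norm_sq, Complex.mul_re,
    Complex.conj_re, Complex.conj_im]
  ring

lemma hasDerivAt_expi (t : ℝ) : HasDerivAt expi (2 * Real.pi * Complex.I * expi t) t := by
  have h1 : HasDerivAt (fun t : ℝ => ((2 * Real.pi * t : ℝ) : ℂ) * Complex.I)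
      (2 * Real.pi * Complex.I) t := by
    have h2 := ((hasDerivAt_id t).const_mul (2 * Real.pi)).ofReal_comp.mul_const Complex.I
    simpa using h2
  have h3 := h1.cexp
  exact h3.congr_deriv (mul_comm _ _)

lemma norm_expi_sub_expi_le (s t : ℝ) : ‖expi s - expi t‖ ≤ 2 * Real.pi * |s - t| := by
  have h := Convex.norm_image_sub_le_of_norm_hasDerivWithin_le (f := expi) (s := Set.univ)
    (C := 2 * Real.pi) (x := t) (y := s)
    (fun x _ => (hasDerivAt_expi x).hasDerivWithinAt) (fun x _ => by
      simp [norm_expi, abs_of_pos Real.pi_pos]) convex_univ trivial trivial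
  simpa [Real.norm_eq_abs] using h

/-- The logarithmic derivative of `∏ (z - ζ j)` in the angular variable, on the circle of
radius `r`, up to the factor `2πi`. -/
noncomputable def cauchySum (n : ℕ) (ζ : ℕ → ℂ) (r θ : ℝ) : ℂ :=
  ∑ j ∈ Finset.range n, r * expi θ / (r * expi θ - ζ j)

lemma le_norm_sub {r : ℝ} (hr : 1 ≤ r) {ζ : ℂ} (hζ : ‖ζ‖ ≤ 1) (θ : ℝ) :
    r - 1 ≤ ‖r * expi θ - ζ‖ := by
  have h := norm_sub_norm_le (r * expi θ) ζ
  rw [norm_mul, norm_expi, mul_one, Complex.norm_real, Real.norm_eq_abs,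
    abs_of_nonneg (by linarith)] at h
  linarith

/-- A Harnack-type comparison: at distance at least 1/n from the ζⱼ, an angular move O(1/n) changes
each kernel by at most a constant times its own real part. These real parts are positive, so the
errors add up to at most a multiple of the modulus of the whole sum. -/
lemma norm_cauchySum_le {n : ℕ} (hn : 0 < n) {ζ : ℕ → ℂ} (hζ : ∀ j, ‖ζ j‖ ≤ 1) {C : ℝ}
    (hC : 0 ≤ C) {θ θ' : ℝ} (hθ : |θ' - θ| ≤ C / n) :
    ‖cauchySum n ζ (1 + 1 / n) θ'‖
      ≤ (1 + 4 * Real.pi * C * (1 + 4 * Real.pi * C)) * ‖cauchySum n ζ (1 + 1 / n) θ‖ := by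
  have hn' : (0 : ℝ) < n := by exact_mod_cast hn
  have hn1 : (1 : ℝ) ≤ n := by exact_mod_cast hn
  set r : ℝ := 1 + 1 / n with hr
  have hinv : 0 < 1 / (n : ℝ) := by positivity
  have hinv1 : 1 / (n : ℝ) ≤ 1 := by rw [div_le_one hn']; exact hn1
  have hr1 : 1 ≤ r := by linarith
  have hr2 : r ≤ 2 := by linarith
  set K := 4 * Real.pi * C with hK
  have hK0 : 0 ≤ K := by positivity
  have hdist : ‖(r : ℂ) * expi θ - r * expi θ'‖ ≤ K * (1 / n) := by
    rw [← mul_sub, norm_mul, Complex.norm_real, Real.norm_eq_abs, abs_of_nonneg (by linarith)]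
    have h1 := norm_expi_sub_expi_le θ θ'
    rw [abs_sub_comm] at h1
    calc r * ‖expi θ - expi θ'‖ ≤ 2 * (2 * Real.pi * (C / n)) := by
          gcongr
          exact h1.trans (by gcongr)
      _ = K * (1 / n) := by rw [hK]; ring
  have hterm : ∀ j, ‖(r : ℂ) * expi θ' / (r * expi θ' - ζ j)
      - r * expi θ / (r * expi θ - ζ j)‖
      ≤ K * (1 + K) * ((r : ℂ) * expi θ / (r * expi θ - ζ j)).re := by
    intro j
    have hd : 1 / (n : ℝ) ≤ ‖(r : ℂ) * expi θ - ζ j‖ := by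
      have := le_norm_sub hr1 (hζ j) θ; rw [hr] at this ⊢; linarith
    have hd' : 1 / (n : ℝ) ≤ ‖(r : ℂ) * expi θ' - ζ j‖ := by
      have := le_norm_sub hr1 (hζ j) θ'; rw [hr] at this ⊢; linarith
    set z : ℂ := r * expi θ with hz
    set z' : ℂ := r * expi θ' with hz'
    have hzn : ‖z‖ = r := by
      rw [hz, norm_mul, norm_expi, mul_one, Complex.norm_real, Real.norm_eq_abs,
        abs_of_nonneg (by linarith)]
    have h0 : z - ζ j ≠ 0 := norm_pos_iff.mp (hinv.trans_le hd)
    have h0' : z' - ζ j ≠ 0 := norm_pos_iff.mp (hinv.trans_le hd')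
    have hcomp : ‖z - ζ j‖ ≤ (1 + K) * ‖z' - ζ j‖ := by
      calc ‖z - ζ j‖ = ‖(z' - ζ j) + (z - z')‖ := by ring_nf
        _ ≤ ‖z' - ζ j‖ + K * (1 / n) := (norm_add_le _ _).trans (by gcongr)
        _ ≤ ‖z' - ζ j‖ + K * ‖z' - ζ j‖ := by gcongr
        _ = _ := by ring
    have hdiff : z' / (z' - ζ j) - z / (z - ζ j)
        = ζ j * (z - z') / ((z' - ζ j) * (z - ζ j)) := by
      field_simp; ring
    -- The numerator of the real part is at least r² - r = r(r - 1) ≥ 1/n.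
    have hre : (1 / n) / ‖z - ζ j‖ ^ 2 ≤ (z / (z - ζ j)).re := by
      have e : (z / (z - ζ j)).re = (‖z‖ ^ 2 - (z * starRingEnd ℂ (ζ j)).re) / ‖z - ζ j‖ ^ 2 := by
        rw [Complex.div_re, ← Complex.normSq_eq_norm_sq, ← Complex.normSq_eq_norm_sq, ← add_div,
          Complex.normSq_apply z]
        congr 1
        simp only [Complex.sub_re, Complex.sub_im, Complex.mul_re, Complex.conj_re,
          Complex.conj_im]
        ring
      rw [e]
      gcongr
      have h1 : (z * starRingEnd ℂ (ζ j)).re ≤ r := by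
        refine (Complex.re_le_norm _).trans ?_
        rw [norm_mul, hzn, RCLike.norm_conj]
        exact mul_le_of_le_one_right (by linarith) (hζ j)
      rw [hzn]; nlinarith
    rw [hdiff, norm_div, norm_mul, norm_mul]
    have hp : 0 < ‖z - ζ j‖ := norm_pos_iff.mpr h0
    have hp' : 0 < ‖z' - ζ j‖ := norm_pos_iff.mpr h0'
    calc ‖ζ j‖ * ‖z - z'‖ / (‖z' - ζ j‖ * ‖z - ζ j‖)
        ≤ 1 * (K * (1 / n)) / (‖z' - ζ j‖ * ‖z - ζ j‖) := by
          gcongr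
          exact hζ j
      _ ≤ K * (1 + K) * ((1 / n) / ‖z - ζ j‖ ^ 2) := by
          rw [div_le_iff₀ (by positivity)]
          have e : K * (1 + K) * ((1 / n) / ‖z - ζ j‖ ^ 2) * (‖z' - ζ j‖ * ‖z - ζ j‖)
              = (K * (1 / n)) * (((1 + K) * ‖z' - ζ j‖) / ‖z - ζ j‖) := by
            field_simp
          rw [e, one_mul]
          refine le_mul_of_one_le_right (by positivity) ?_
          rw [one_le_div hp]; exact hcomp
      _ ≤ _ := by gcongr
  have hsum : ‖cauchySum n ζ r θ' - cauchySum n ζ r θ‖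
      ≤ K * (1 + K) * ‖cauchySum n ζ r θ‖ := by
    rw [cauchySum, cauchySum, ← Finset.sum_sub_distrib]
    refine (norm_sum_le _ _).trans ((Finset.sum_le_sum fun j _ => hterm j).trans ?_)
    rw [← Finset.mul_sum, ← Complex.re_sum]
    gcongr
    exact Complex.re_le_norm _
  calc ‖cauchySum n ζ r θ'‖ = ‖cauchySum n ζ r θ + (cauchySum n ζ r θ' - cauchySum n ζ r θ)‖ := by
        ring_nf
    _ ≤ ‖cauchySum n ζ r θ‖ + K * (1 + K) * ‖cauchySum n ζ r θ‖ :=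
        (norm_add_le _ _).trans (by gcongr)
    _ = _ := by ring

/-- Mean value inequality: the derivative of the sum of logarithms is the real part of 2πi times
`cauchySum`, which is controlled on the whole interval by its value at θ. -/
lemma abs_sum_log_norm_sub_le {n : ℕ} (hn : 0 < n) {ζ : ℕ → ℂ} (hζ : ∀ j, ‖ζ j‖ ≤ 1) {C : ℝ}
    (hC : 0 ≤ C) {ε : ℝ} (hε : |ε| ≤ C / n) (θ : ℝ) :
    |∑ j ∈ Finset.range n, (Real.log ‖(1 + 1 / n : ℝ) * expi (θ - ε) - ζ j‖
        - Real.log ‖(1 + 1 / n : ℝ) * expi θ - ζ j‖)|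
      ≤ 2 * Real.pi * C * (1 + 4 * Real.pi * C * (1 + 4 * Real.pi * C))
        * ‖cauchySum n ζ (1 + 1 / n) θ / n‖ := by
  have hn' : (0 : ℝ) < n := by exact_mod_cast hn
  set r : ℝ := 1 + 1 / n with hr
  have hinv : 0 < 1 / (n : ℝ) := by positivity
  have hr1 : 1 ≤ r := by linarith
  set M := 1 + 4 * Real.pi * C * (1 + 4 * Real.pi * C) with hM
  have hne : ∀ t j, (r : ℂ) * expi t - ζ j ≠ 0 := by
    intro t j
    refine norm_pos_iff.mp (lt_of_lt_of_le ?_ (le_norm_sub hr1 (hζ j) t))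
    linarith
  have hder : ∀ t, HasDerivAt (fun s => ∑ j ∈ Finset.range n, Real.log ‖r * expi s - ζ j‖)
      ((2 * Real.pi * Complex.I) * cauchySum n ζ r t).re t := by
    intro t
    have h1 : ∀ j ∈ Finset.range n, HasDerivAt (fun s => Real.log ‖r * expi s - ζ j‖)
        ((r * (2 * Real.pi * Complex.I * expi t)) / (r * expi t - ζ j)).re t := fun j _ =>
      hasDerivAt_log_norm (F := fun s => r * expi s - ζ j)
        (((hasDerivAt_expi t).const_mul (r : ℂ)).sub_const _) (hne t j)
    have h2 := HasDerivAt.fun_sum h1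
    refine h2.congr_deriv ?_
    rw [cauchySum, Finset.mul_sum, Complex.re_sum]
    refine Finset.sum_congr rfl fun j _ => ?_
    congr 1; ring
  have hmvt := Convex.norm_image_sub_le_of_norm_hasDerivWithin_le
    (f := fun s => ∑ j ∈ Finset.range n, Real.log ‖r * expi s - ζ j‖)
    (s := Metric.closedBall θ (C / n)) (C := 2 * Real.pi * (M * ‖cauchySum n ζ r θ‖))
    (x := θ) (y := θ - ε)
    (fun x _ => (hder x).hasDerivWithinAt) (fun x hx => by
      rw [Real.norm_eq_abs]
      refine (Complex.abs_re_le_norm _).trans ?_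
      rw [norm_mul]
      have h3 : ‖(2 * Real.pi * Complex.I : ℂ)‖ = 2 * Real.pi := by
        simp [abs_of_pos Real.pi_pos]
      rw [h3]
      gcongr
      exact norm_cauchySum_le hn hζ hC (by simpa [Real.dist_eq] using hx))
    (convex_closedBall _ _) (Metric.mem_closedBall_self (by positivity))
    (by simpa [Real.dist_eq] using hε)
  rw [Finset.sum_sub_distrib]
  rw [Real.norm_eq_abs] at hmvt
  refine hmvt.trans ?_
  have h4 : ‖θ - ε - θ‖ = |ε| := by rw [Real.norm_eq_abs]; simp
  have h5 : ‖cauchySum n ζ r θ / n‖ = ‖cauchySum n ζ r θ‖ / n := by simp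
  rw [h4, h5]
  calc 2 * Real.pi * (M * ‖cauchySum n ζ r θ‖) * |ε|
      ≤ 2 * Real.pi * (M * ‖cauchySum n ζ r θ‖) * (C / n) := by gcongr
    _ = _ := by ring

/-- Conjugation turns the kernels at radius r > 0 into the form with parameter 1/r to which
Kolmogorov's inequality applies. -/
lemma norm_cauchySum_eq (n : ℕ) (ζ : ℕ → ℂ) {r : ℝ} (hr : 0 < r) (θ : ℝ) :
    ‖cauchySum n ζ r θ / n‖ = ‖(∑ j ∈ Finset.range n,
      (1 - starRingEnd ℂ (ζ j) * ((r⁻¹ : ℝ) * expi θ))⁻¹) / n‖ := by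
  rw [norm_div, norm_div]
  congr 1
  rw [← RCLike.norm_conj (cauchySum n ζ r θ), cauchySum, map_sum]
  congr 1
  refine Finset.sum_congr rfl fun j _ => ?_
  have hconj : starRingEnd ℂ (expi θ) = (expi θ)⁻¹ := by
    rw [Complex.inv_def, Complex.normSq_eq_norm_sq, norm_expi]; simp
  have hr' : (r : ℂ) ≠ 0 := by exact_mod_cast hr.ne'
  have he := expi_ne_zero θ
  rw [map_div₀, map_sub, map_mul, hconj, Complex.conj_ofReal, ← inv_div]
  congr 1
  push_cast
  field_simp

lemma cauchySum_periodic (n : ℕ) (ζ : ℕ → ℂ) (r : ℝ) :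
    Function.Periodic (cauchySum n ζ r) 1 := by
  intro θ
  simp only [cauchySum, expi_periodic θ]

end CircleEstimates

/-! ### Boundedness in measure of shifted products -/

section Tightness

lemma sqrt_le_add_one {x : ℝ} (hx : 0 ≤ x) : √x ≤ x + 1 := by
  rw [Real.sqrt_le_left (by linarith)]; nlinarith

lemma sqrt_add_le_add_sqrt {x y : ℝ} (hx : 0 ≤ x) (hy : 0 ≤ y) : √(x + y) ≤ √x + √y := by
  rw [Real.sqrt_le_left (by positivity)]
  nlinarith [Real.sq_sqrt hx, Real.sq_sqrt hy, Real.sqrt_nonneg x, Real.sqrt_nonneg y,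
    mul_nonneg (Real.sqrt_nonneg x) (Real.sqrt_nonneg y)]

lemma countable_setOf_expi_eq (ζ : ℂ) : {θ : ℝ | expi θ = ζ}.Countable := by
  by_cases h : ∃ θ₀, expi θ₀ = ζ
  · obtain ⟨θ₀, hθ₀⟩ := h
    refine (Set.countable_range fun n : ℤ => θ₀ + n).mono ?_
    intro θ hθ
    have h1 : expi (θ - θ₀) = 1 := by
      rw [expi_sub, hθ₀, Set.mem_ofPred_eq.mp hθ, div_self]
      rw [← hθ₀]; exact expi_ne_zero _
    obtain ⟨n, hn⟩ := expi_eq_one_iff.mp h1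
    exact ⟨n, by simp only; linarith⟩
  · convert Set.countable_empty
    ext θ
    simp only [Set.mem_ofPred_eq, Set.mem_empty_iff_false, iff_false]
    exact fun h1 => h ⟨θ, h1⟩

lemma ae_expi_ne (ζ : ℂ) : ∀ᵐ θ : ℝ, expi θ ≠ ζ := by
  rw [ae_iff]
  simpa using (countable_setOf_expi_eq ζ).measure_zero volume

/-- An integrable periodic majorant, of bounded integral, for the square root of the logarithmic
increment of a product of `n` factors over an angle `ε = O(1/n)`. -/
lemma exists_periodic_majorant {C : ℝ} (hC : 0 ≤ C) :
    ∃ K : ℝ, 0 ≤ K ∧ ∀ n : ℕ, 0 < n → ∀ ζ : ℕ → ℂ, (∀ j, ‖ζ j‖ ≤ 1) → ∀ ε : ℝ, |ε| ≤ C / n →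
      ∃ Ψ : ℝ → ℝ, Function.Periodic Ψ 1 ∧ IntervalIntegrable Ψ volume 0 1 ∧
        ∫ θ in (0 : ℝ)..1, Ψ θ ≤ K ∧
        ∀ᵐ θ, √|∑ j ∈ Finset.range n, (Real.log ‖expi (θ - ε) - ζ j‖
          - Real.log ‖expi θ - ζ j‖)| ≤ Ψ θ := by
  set M := 2 * Real.pi * C * (1 + 4 * Real.pi * C * (1 + 4 * Real.pi * C)) with hM
  have hM0 : 0 ≤ M := by positivity
  -- The terms bound the integrals of the radial gap, of its translate, of the constant 2, and of
  -- the Kolmogorov term.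
  refine ⟨1 + 1 + 2 + √M * √2, by positivity, ?_⟩
  intro n hn ζ hζ ε hε
  have hn' : (0 : ℝ) < n := by exact_mod_cast hn
  -- At this radius the n radial gaps have total integral n log r ≤ 1, while the circle stays at
  -- distance 1/n from the zeros, the scale of the shift ε.
  set r : ℝ := 1 + 1 / n with hr
  have hinv : 0 < 1 / (n : ℝ) := by positivity
  have hr1 : 1 < r := by linarith
  have hr0 : 0 < r := by linarith
  set g : ℝ → ℝ := fun θ => ∑ j ∈ Finset.range n, logGap r (ζ j) θ with hg
  have hgper : Function.Periodic g 1 := fun θ => by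
    simp only [hg, fun j => logGap_periodic r (ζ j) θ]
  have hgint : IntervalIntegrable g volume 0 1 := by
    have h := IntervalIntegrable.sum (Finset.range n) (f := fun j => logGap r (ζ j))
      fun j _ => intervalIntegrable_logGap r (ζ j)
    have e : (∑ j ∈ Finset.range n, logGap r (ζ j)) = g := by
      funext θ
      rw [Finset.sum_apply]
    exact e ▸ h
  have hgle : ∫ θ in (0 : ℝ)..1, g θ ≤ 1 := by
    rw [hg, intervalIntegral.integral_finsetSum fun j _ => intervalIntegrable_logGap r (ζ j)]
    simp only [fun j => integral_logGap hr1.le (hζ j), Finset.sum_const, Finset.card_range,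
      nsmul_eq_mul]
    have := Real.log_le_sub_one_of_pos hr0
    calc (n : ℝ) * Real.log r ≤ n * (1 / n) := by gcongr; linarith
      _ = 1 := by field_simp
  have hgall := hgper.intervalIntegrable₀ one_ne_zero hgint
  set c : ℝ → ℝ := fun θ => √‖cauchySum n ζ r θ / n‖ with hc
  have hcper : Function.Periodic c 1 := fun θ => by
    simp only [hc, cauchySum_periodic n ζ r θ]
  have hccont : Continuous c := by
    refine Real.continuous_sqrt.comp (Continuous.norm (Continuous.div_const ?_ _))
    refine continuous_finsetSum _ fun j _ => ?_
    refine Continuous.div (by fun_prop) (by fun_prop) fun θ => ?_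
    refine norm_pos_iff.mp (lt_of_lt_of_le ?_ (le_norm_sub hr1.le (hζ j) θ))
    linarith
  have hcle : ∫ θ in (0 : ℝ)..1, c θ ≤ √2 := by
    simp only [hc, norm_cauchySum_eq n ζ hr0]
    refine integral_sqrt_norm_sum_le hn (ζ := fun j => starRingEnd ℂ (ζ j)) (fun j => ?_)
      (inv_pos.mpr hr0) (inv_lt_one_of_one_lt₀ hr1)
    rw [RCLike.norm_conj]; exact hζ j
  have hgshift : ∫ θ in (0 : ℝ)..1, g (θ - ε) = ∫ θ in (0 : ℝ)..1, g θ := by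
    rw [intervalIntegral.integral_comp_sub_right g ε,
      show (1 : ℝ) - ε = (0 - ε) + 1 by ring, hgper.intervalIntegral_add_eq (0 - ε) 0, zero_add]
  have hgsint : IntervalIntegrable (fun θ => g (θ - ε)) volume 0 1 := by
    have := (hgall (0 - ε) (1 - ε)).comp_sub_right ε
    simpa using this
  refine ⟨fun θ => g θ + g (θ - ε) + 2 + √M * c θ, ?_, ?_, ?_, ?_⟩
  · intro θ
    have e : θ + 1 - ε = θ - ε + 1 := by ring
    simp only [hgper θ, hcper θ, e, hgper (θ - ε)]
  · exact ((hgint.add hgsint).add intervalIntegrable_const).add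
      ((hccont.intervalIntegrable _ _).const_mul _)
  · rw [intervalIntegral.integral_add ((hgint.add hgsint).add intervalIntegrable_const)
      ((hccont.intervalIntegrable _ _).const_mul _),
      intervalIntegral.integral_add (hgint.add hgsint) intervalIntegrable_const,
      intervalIntegral.integral_add hgint hgsint, hgshift, intervalIntegral.integral_const_mul]
    simp only [intervalIntegral.integral_const, sub_zero, smul_eq_mul, one_mul]
    gcongr
  · have hne : ∀ᵐ θ : ℝ, ∀ j, expi θ ≠ ζ j := ae_all_iff.mpr fun j => ae_expi_ne (ζ j)
    have hne' : ∀ᵐ θ : ℝ, ∀ j, expi (θ - ε) ≠ ζ j :=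
      (measurePreserving_sub_right volume ε).quasiMeasurePreserving.ae hne
    filter_upwards [hne, hne'] with θ h1 h2
    have hg0 : 0 ≤ g θ := Finset.sum_nonneg fun j _ => logGap_nonneg hr1.le (hζ j) (h1 j)
    have hg0' : 0 ≤ g (θ - ε) := Finset.sum_nonneg fun j _ => logGap_nonneg hr1.le (hζ j) (h2 j)
    set D := ∑ j ∈ Finset.range n, (Real.log ‖(r : ℂ) * expi (θ - ε) - ζ j‖
        - Real.log ‖(r : ℂ) * expi θ - ζ j‖) with hD
    have hDle : |D| ≤ M * ‖cauchySum n ζ r θ / n‖ := abs_sum_log_norm_sub_le hn hζ hC hε θ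
    -- Pass to radius r at both angles: the increment on the unit circle is the increment D at
    -- radius r plus a difference of two nonnegative gaps.
    have hsum : ∑ j ∈ Finset.range n, (Real.log ‖expi (θ - ε) - ζ j‖
          - Real.log ‖expi θ - ζ j‖) = g θ - g (θ - ε) + D := by
      rw [hg, hD, ← Finset.sum_sub_distrib, ← Finset.sum_add_distrib]
      refine Finset.sum_congr rfl fun j _ => ?_
      simp only [logGap]; ring
    rw [hsum]
    have habs : |g θ - g (θ - ε) + D| ≤ g θ + g (θ - ε) + M * ‖cauchySum n ζ r θ / n‖ := by
      have := abs_le.mp hDle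
      rw [abs_le]; constructor <;> linarith
    calc √|g θ - g (θ - ε) + D| ≤ √(g θ + g (θ - ε) + M * ‖cauchySum n ζ r θ / n‖) :=
          Real.sqrt_le_sqrt habs
      _ ≤ √(g θ + g (θ - ε)) + √(M * ‖cauchySum n ζ r θ / n‖) :=
          sqrt_add_le_add_sqrt (add_nonneg hg0 hg0') (by positivity)
      _ ≤ (g θ + g (θ - ε) + 2) + √M * c θ := by
          rw [Real.sqrt_mul hM0]
          have := sqrt_le_add_one (add_nonneg hg0 hg0')
          gcongr
          linarith

/-- Uniform boundedness in measure on bounded intervals. -/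
def IsTight (U : ℕ → ℝ → ℝ) : Prop :=
  ∀ R κ : ℝ, 0 < κ → ∃ L : ℝ, ∀ k,
    volume {x | x ∈ Set.Icc (-R) R ∧ L < |U k x|} ≤ ENNReal.ofReal κ

lemma IsTight.congr_ae {U V : ℕ → ℝ → ℝ} (hU : IsTight U) (h : ∀ k, ∀ᵐ x, V k x = U k x) :
    IsTight V := by
  intro R κ hκ
  obtain ⟨L, hL⟩ := hU R κ hκ
  refine ⟨L, fun k => le_trans (measure_mono_ae ?_) (hL k)⟩
  filter_upwards [h k] with x hx hxV
  exact ⟨hxV.1, hx ▸ hxV.2⟩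

lemma IsTight.add {U V : ℕ → ℝ → ℝ} (hU : IsTight U) (hV : IsTight V) :
    IsTight (fun k x => U k x + V k x) := by
  intro R κ hκ
  obtain ⟨L, hL⟩ := hU R (κ / 2) (by positivity)
  obtain ⟨L', hL'⟩ := hV R (κ / 2) (by positivity)
  refine ⟨L + L', fun k => ?_⟩
  calc volume {x | x ∈ Set.Icc (-R) R ∧ L + L' < |U k x + V k x|}
      ≤ volume ({x | x ∈ Set.Icc (-R) R ∧ L < |U k x|} ∪
          {x | x ∈ Set.Icc (-R) R ∧ L' < |V k x|}) := by
        refine measure_mono ?_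
        rintro x ⟨hx, hlt⟩
        by_contra hcon
        simp only [Set.mem_union, Set.mem_ofPred_eq, not_or, not_and, not_lt] at hcon
        have h1 := hcon.1 hx
        have h2 := hcon.2 hx
        have h3 := abs_add_le (U k x) (V k x)
        linarith
    _ ≤ ENNReal.ofReal (κ / 2) + ENNReal.ofReal (κ / 2) :=
        (measure_union_le _ _).trans (add_le_add (hL k) (hL' k))
    _ = ENNReal.ofReal κ := by
        rw [← ENNReal.ofReal_add (by positivity) (by positivity)]; congr 1; ring

lemma IsTight.neg {U : ℕ → ℝ → ℝ} (hU : IsTight U) : IsTight (fun k x => - U k x) := by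
  intro R κ hκ
  obtain ⟨L, hL⟩ := hU R κ hκ
  exact ⟨L, fun k => by simpa using hL k⟩

lemma isTight_zero : IsTight (fun _ _ => 0) := by
  intro R κ hκ
  exact ⟨0, fun k => by simp⟩

/-- Markov's inequality for the periodic majorant, whose integral bound depends neither on n nor on
the zeros. -/
lemma isTight_log_norm_increment {γ : ℝ} (hγ : γ ≠ 0) {N : ℕ → ℕ} (hN : ∀ k, 0 < N k)
    {ζ : ℕ → ℕ → ℂ} (hζ : ∀ k j, ‖ζ k j‖ ≤ 1) {C : ℝ} (hC : 0 ≤ C) {ε : ℕ → ℝ}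
    (hε : ∀ k, |ε k| ≤ C / N k) :
    IsTight (fun k x => ∑ j ∈ Finset.range (N k), (Real.log ‖expi (γ * x - ε k) - ζ k j‖
      - Real.log ‖expi (γ * x) - ζ k j‖)) := by
  obtain ⟨K, hK0, hK⟩ := exists_periodic_majorant hC
  intro R κ hκ
  obtain ⟨m, hm⟩ := exists_nat_gt (|γ| * R)
  have hγ' : 0 < |γ| := abs_pos.mpr hγ
  -- The interval [-R, R] is mapped by γ into (-m, m), where the majorant has integral at most 2mK;
  -- this s makes the exceptional set of angles smaller than |γ|κ. The threshold is s² because the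
  -- majorant bounds a square root.
  set s : ℝ := (2 * m * K + 1) / (|γ| * κ) with hs
  have hs0 : 0 < s := by positivity
  refine ⟨s ^ 2, fun k => ?_⟩
  obtain ⟨Ψ, hper, hint, hle, hae⟩ := hK (N k) (hN k) (ζ k) (hζ k) (ε k) (hε k)
  have hall := hper.intervalIntegrable₀ one_ne_zero hint
  have hint2 : ∫ θ in (-m : ℝ)..m, Ψ θ ≤ 2 * m * K := by
    have h := hper.intervalIntegral_add_zsmul_eq (2 * m : ℤ) (-m) hall
    have e : -(m : ℝ) + (2 * m : ℤ) • (1 : ℝ) = m := by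
      simp only [zsmul_eq_mul, Int.cast_mul, Int.cast_ofNat, Int.cast_natCast, mul_one]; ring
    rw [e, hper.intervalIntegral_add_eq (-m) 0, zero_add] at h
    rw [h, zsmul_eq_mul]
    push_cast
    gcongr
  rw [intervalIntegral.integral_of_le (by
    have : (0 : ℝ) ≤ m := by positivity
    linarith)] at hint2
  have hΨ0 : 0 ≤ᵐ[volume.restrict (Set.Ioc (-m : ℝ) m)] Ψ := by
    refine ae_restrict_of_ae ?_
    filter_upwards [hae] with θ hθ
    exact (Real.sqrt_nonneg _).trans hθ
  have hmarkov := mul_meas_ge_le_integral_of_nonneg hΨ0 (hall (-m) m).1 s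
  set T : Set ℝ := {θ | θ ∈ Set.Ioc (-m : ℝ) m ∧ s ≤ Ψ θ} with hT
  have hTfin : volume T ≠ ⊤ :=
    ne_top_of_le_ne_top (by simp) (measure_mono (fun θ hθ => hθ.1 : T ⊆ Set.Ioc (-m : ℝ) m))
  have hTreal : s * volume.real T ≤ 2 * m * K := by
    refine le_trans (mul_le_mul_of_nonneg_left ?_ hs0.le) (hmarkov.trans hint2)
    refine ENNReal.toReal_mono (measure_ne_top _ _) ?_
    refine le_trans (measure_mono ?_) (Measure.le_restrict_apply _ _)
    rintro θ ⟨h1, h2⟩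
    exact ⟨h2, h1⟩
  have hTle : volume T ≤ ENNReal.ofReal (|γ| * κ) := by
    rw [← ENNReal.ofReal_toReal hTfin]
    refine ENNReal.ofReal_le_ofReal ?_
    have h1 : s * (|γ| * κ) = 2 * m * K + 1 := by rw [hs]; field_simp
    have h2 : s * volume.real T ≤ s * (|γ| * κ) := by linarith
    exact le_of_mul_le_mul_left h2 hs0
  calc volume {x | x ∈ Set.Icc (-R) R ∧ s ^ 2 < |∑ j ∈ Finset.range (N k),
        (Real.log ‖expi (γ * x - ε k) - ζ k j‖ - Real.log ‖expi (γ * x) - ζ k j‖)|}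
      ≤ volume ((fun x => γ * x) ⁻¹' T) := by
        refine measure_mono_ae ?_
        have hq : Measure.QuasiMeasurePreserving (fun x : ℝ => γ * x) volume volume := by
          refine ⟨measurable_const_mul γ, ?_⟩
          rw [Real.map_volume_mul_left hγ]
          exact Measure.smul_absolutelyContinuous
        filter_upwards [hq.ae hae] with x hx
        rintro ⟨hxR, hlt⟩
        change γ * x ∈ T
        have hb : |γ * x| < m := by
          rw [abs_mul]
          exact lt_of_le_of_lt (by gcongr; exact abs_le.mpr hxR) hm
        refine ⟨⟨(abs_lt.mp hb).1, (abs_lt.mp hb).2.le⟩, ?_⟩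
        refine le_trans ?_ hx
        exact Real.le_sqrt_of_sq_le hlt.le
    _ = ENNReal.ofReal |γ⁻¹| * volume T := Real.volume_preimage_mul_left hγ T
    _ ≤ ENNReal.ofReal |γ⁻¹| * ENNReal.ofReal (|γ| * κ) := by gcongr
    _ = ENNReal.ofReal κ := by
        rw [← ENNReal.ofReal_mul (abs_nonneg _), abs_inv]
        congr 1
        field_simp

/-- The logarithm of `∏_{j < N} E(x + (j - N) δ) / ∏_{j < N} E(x + j δ)`. -/
noncomputable def logShift (δ : ℝ) (N : ℕ) (E : ℝ → ℝ) (x : ℝ) : ℝ :=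
  ∑ j ∈ Finset.range N, (Real.log (E (x + j * δ - N * δ)) - Real.log (E (x + j * δ)))

/-- `E` is nonzero almost everywhere and its products over `N k` steps of length `δ` change by a
factor bounded in measure when shifted by `N k` steps. -/
def TightFactor (δ : ℝ) (N : ℕ → ℕ) (E : ℝ → ℝ) : Prop :=
  (∀ᵐ x, E x ≠ 0) ∧ IsTight fun k => logShift δ (N k) E

lemma ae_comp_add {p : ℝ → Prop} (h : ∀ᵐ x, p x) (t : ℝ) : ∀ᵐ x, p (x + t) :=
  (measurePreserving_add_right volume t).quasiMeasurePreserving.ae h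

lemma TightFactor.mul {δ : ℝ} {N : ℕ → ℕ} {E F : ℝ → ℝ} (hE : TightFactor δ N E)
    (hF : TightFactor δ N F) : TightFactor δ N (fun x => E x * F x) := by
  refine ⟨?_, ?_⟩
  · filter_upwards [hE.1, hF.1] with x h1 h2 using mul_ne_zero h1 h2
  · refine (hE.2.add hF.2).congr_ae fun k => ?_
    have hboth : ∀ᵐ x, E x ≠ 0 ∧ F x ≠ 0 := hE.1.and hF.1
    have h1 : ∀ᵐ x : ℝ, ∀ j : ℕ, E (x + j * δ) ≠ 0 ∧ F (x + j * δ) ≠ 0 :=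
      ae_all_iff.mpr fun j => ae_comp_add hboth (j * δ)
    have h2 : ∀ᵐ x : ℝ, ∀ j : ℕ, E (x + j * δ - N k * δ) ≠ 0 ∧ F (x + j * δ - N k * δ) ≠ 0 :=
      ae_all_iff.mpr fun j => by
        have := ae_comp_add hboth (j * δ - N k * δ)
        simpa only [add_sub_assoc] using this
    filter_upwards [h1, h2] with x hx1 hx2
    simp only [logShift, ← Finset.sum_add_distrib]
    refine Finset.sum_congr rfl fun j _ => ?_
    rw [Real.log_mul (hx1 j).1 (hx1 j).2, Real.log_mul (hx2 j).1 (hx2 j).2]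
    ring

lemma tightFactor_const (δ : ℝ) (N : ℕ → ℕ) {c : ℝ} (hc : c ≠ 0) :
    TightFactor δ N (fun _ => c) := by
  refine ⟨Eventually.of_forall fun _ => hc, ?_⟩
  have h : (fun k => logShift δ (N k) fun _ => c) = fun _ _ => 0 := by
    funext k x
    simp [logShift]
  rw [h]
  exact isTight_zero

/-- Reflection in the unit circle, used to bring zeros outside the disc inside; the factor ‖ζ‖
disappears in differences of logarithms. -/
lemma norm_expi_sub_of_one_lt {ζ : ℂ} (hζ : ζ ≠ 0) (θ : ℝ) :
    ‖expi θ - ζ‖ = ‖ζ‖ * ‖expi θ - (starRingEnd ℂ ζ)⁻¹‖ := by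
  have hconj : starRingEnd ℂ (expi θ) = (expi θ)⁻¹ := by
    rw [Complex.inv_def, Complex.normSq_eq_norm_sq, norm_expi]; simp
  have he := expi_ne_zero θ
  rw [← RCLike.norm_conj (expi θ - (starRingEnd ℂ ζ)⁻¹), map_sub, map_inv₀, Complex.conj_conj,
    hconj, ← norm_mul, ← mul_one ‖ζ * _‖, ← norm_expi θ, ← norm_mul, ← norm_neg]
  congr 1
  field_simp
  ring

lemma tightFactor_norm_expi_sub {γ : ℝ} (hγ : γ ≠ 0) {δ : ℝ} {N : ℕ → ℕ} (hN : ∀ k, 0 < N k)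
    {C : ℝ} (hC : 0 ≤ C) (happ : ∀ k, ∃ p : ℤ, |N k * (γ * δ) - p| ≤ C / N k) (ζ : ℂ) :
    TightFactor δ N (fun x => ‖expi (γ * x) - ζ‖) := by
  have hmain : ∀ ζ : ℂ, ‖ζ‖ ≤ 1 → IsTight fun k => logShift δ (N k) fun x => ‖expi (γ * x) - ζ‖ := by
    intro ζ hζ
    choose p hp using happ
    -- Rotating the j-th factor back puts all factors at the same angle with zeros ζ e(-jγδ). The
    -- shift by Nδ is then, modulo the integer p, a rotation by ε = Nγδ - p.
    refine (isTight_log_norm_increment hγ hN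
      (ζ := fun _ j => ζ * expi (-(j * (γ * δ)))) (fun k j => ?_) hC
      (ε := fun k => N k * (γ * δ) - p k) hp).congr_ae fun k => Eventually.of_forall fun x => ?_
    · rw [norm_mul, norm_expi, mul_one]; exact hζ
    · refine Finset.sum_congr rfl fun j _ => ?_
      have key : ∀ y : ℝ, ‖expi (y + j * (γ * δ)) - ζ‖ = ‖expi y - ζ * expi (-(j * (γ * δ)))‖ := by
        intro y
        rw [expi_add, expi_neg, ← mul_one ‖expi y - _‖, ← norm_expi (j * (γ * δ)), ← norm_mul]
        congr 1
        rw [sub_mul, mul_assoc ζ, inv_mul_cancel₀ (expi_ne_zero _), mul_one]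
      congr 2
      · change ‖expi (γ * (x + j * δ - N k * δ)) - ζ‖ = _
        rw [← key]
        have e : γ * (x + j * δ - N k * δ)
            = γ * x - (N k * (γ * δ) - p k) + j * (γ * δ) + ((-p k : ℤ) : ℝ) := by
          push_cast; ring
        rw [e, expi_add _ ((-p k : ℤ) : ℝ), expi_int, mul_one]
      · change ‖expi (γ * (x + j * δ)) - ζ‖ = _
        rw [← key, mul_add, mul_left_comm γ]
  refine ⟨?_, ?_⟩
  · have hq : Measure.QuasiMeasurePreserving (fun x : ℝ => γ * x) volume volume := by
      refine ⟨measurable_const_mul γ, ?_⟩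
      rw [Real.map_volume_mul_left hγ]
      exact Measure.smul_absolutelyContinuous
    filter_upwards [hq.ae (ae_expi_ne ζ)] with x hx
    exact norm_ne_zero_iff.mpr (sub_ne_zero.mpr hx)
  · rcases le_or_gt ‖ζ‖ 1 with h | h
    · exact hmain ζ h
    · have hζ0 : ζ ≠ 0 := by rintro rfl; simp at h; linarith
      have hinv : ‖(starRingEnd ℂ ζ)⁻¹‖ < 1 := by
        rw [norm_inv, RCLike.norm_conj]; exact inv_lt_one_of_one_lt₀ h
      have h1 := hmain _ hinv.le
      refine h1.congr_ae fun k => ?_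
      have hae : ∀ᵐ x : ℝ, ‖expi (γ * x) - (starRingEnd ℂ ζ)⁻¹‖ ≠ 0 := by
        refine Eventually.of_forall fun x => norm_ne_zero_iff.mpr (sub_ne_zero.mpr fun h2 => ?_)
        rw [← h2, norm_expi] at hinv
        exact lt_irrefl _ hinv
      have h3 : ∀ᵐ x : ℝ, ∀ j : ℕ, ‖expi (γ * (x + j * δ)) - (starRingEnd ℂ ζ)⁻¹‖ ≠ 0 :=
        ae_all_iff.mpr fun j => ae_comp_add hae (j * δ)
      have h4 : ∀ᵐ x : ℝ, ∀ j : ℕ,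
          ‖expi (γ * (x + j * δ - N k * δ)) - (starRingEnd ℂ ζ)⁻¹‖ ≠ 0 :=
        ae_all_iff.mpr fun j => by
          have := ae_comp_add hae (j * δ - N k * δ)
          simpa only [add_sub_assoc] using this
      filter_upwards [h3, h4] with x hx3 hx4
      refine Finset.sum_congr rfl fun j _ => ?_
      simp only [norm_expi_sub_of_one_lt hζ0]
      rw [Real.log_mul (norm_ne_zero_iff.mpr hζ0) (hx3 j),
        Real.log_mul (norm_ne_zero_iff.mpr hζ0) (hx4 j)]
      ring

lemma tightFactor_norm_polynomial_eval {γ : ℝ} (hγ : γ ≠ 0) {δ : ℝ} {N : ℕ → ℕ}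
    (hN : ∀ k, 0 < N k) {C : ℝ} (hC : 0 ≤ C)
    (happ : ∀ k, ∃ p : ℤ, |N k * (γ * δ) - p| ≤ C / N k) {q : Polynomial ℂ} (hq : q ≠ 0) :
    TightFactor δ N (fun x => ‖q.eval (expi (γ * x))‖) := by
  have hprod : ∀ s : Multiset ℂ, TightFactor δ N
      (fun x => ‖((s.map fun a => Polynomial.X - Polynomial.C a).prod).eval (expi (γ * x))‖) := by
    intro s
    induction s using Multiset.induction_on with
    | empty => simpa using tightFactor_const δ N one_ne_zero
    | cons a s ih =>
      have := (tightFactor_norm_expi_sub hγ hN hC happ a).mul ih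
      simpa [Polynomial.eval_mul] using this
  have h := (tightFactor_const δ N (norm_ne_zero_iff.mpr
    (Polynomial.leadingCoeff_ne_zero.mpr hq))).mul (hprod q.roots)
  have hs := (IsAlgClosed.splits q).eq_prod_roots
  have e : (fun x => ‖q.eval (expi (γ * x))‖) = fun x => ‖q.leadingCoeff‖ *
      ‖((q.roots.map fun a => Polynomial.X - Polynomial.C a).prod).eval (expi (γ * x))‖ := by
    funext x
    conv_lhs => rw [hs]
    rw [Polynomial.eval_mul, Polynomial.eval_C, norm_mul]
  rw [e]
  exact h

end Tightness

/-! ### Trigonometric polynomials as polynomials in several variables -/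

section TrigonometricPolynomials

open MvPolynomial

variable {ι : Type*} (γ : ι → ℝ)

/-- The frequency of a monomial when the `i`-th variable is given frequency `γ i`. -/
def freq [Fintype ι] (n : ι →₀ ℕ) : ℝ := ∑ i, n i * γ i

/-- Evaluation of a polynomial at `X i = expi (γ i * x)`. -/
noncomputable def trigEval (x : ℝ) : MvPolynomial ι ℂ →ₐ[ℂ] ℂ :=
  aeval fun i => expi (γ i * x)

lemma trigEval_monomial [Fintype ι] (x : ℝ) (n : ι →₀ ℕ) (a : ℂ) :
    trigEval γ x (monomial n a) = a * expi (freq γ n * x) := by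
  rw [trigEval, aeval_monomial, Finsupp.prod_fintype _ _ (by simp), freq, Finset.sum_mul, expi_sum]
  simp only [mul_assoc, expi_nat_mul]
  rfl

lemma trigEval_eq_sum [Fintype ι] (x : ℝ) (P : MvPolynomial ι ℂ) :
    trigEval γ x P = ∑ n ∈ P.support, coeff n P * expi (freq γ n * x) := by
  conv_lhs => rw [P.as_sum]
  rw [map_sum]
  simp only [trigEval_monomial]

/-- The algebra map corresponding to translating trigonometric polynomials by `t`. -/
noncomputable def shiftHom (t : ℝ) : MvPolynomial ι ℂ →ₐ[ℂ] MvPolynomial ι ℂ :=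
  aeval fun i => C (expi (γ i * t)) * X i

lemma shiftHom_add (s t : ℝ) (P : MvPolynomial ι ℂ) :
    shiftHom γ (s + t) P = shiftHom γ s (shiftHom γ t P) := by
  rw [← AlgHom.comp_apply]
  congr 1
  refine algHom_ext fun i => ?_
  simp only [shiftHom, aeval_X, AlgHom.comp_apply, map_mul, mul_add, expi_add, algHom_C,
    algebraMap_eq]
  ring

lemma shiftHom_zero (P : MvPolynomial ι ℂ) : shiftHom γ 0 P = P := by
  rw [← AlgHom.id_apply (R := ℂ) P, ← AlgHom.comp_apply]
  congr 1
  refine algHom_ext fun i => ?_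
  simp [shiftHom, expi_zero]

/-- Translation by `t` as a multiplicative automorphism. -/
noncomputable def shift : Multiplicative ℝ →* MulAut (MvPolynomial ι ℂ) where
  toFun t :=
    { toFun := shiftHom γ t.toAdd
      invFun := shiftHom γ (-t.toAdd)
      left_inv := fun P => by rw [← shiftHom_add, neg_add_cancel, shiftHom_zero]
      right_inv := fun P => by rw [← shiftHom_add, add_neg_cancel, shiftHom_zero]
      map_mul' := map_mul _ }
  map_one' := by ext1 P; exact shiftHom_zero γ P
  map_mul' s t := by ext1 P; exact shiftHom_add γ s.toAdd t.toAdd P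

lemma shift_apply (t : ℝ) (P : MvPolynomial ι ℂ) :
    shift γ (.ofAdd t) P = shiftHom γ t P := rfl

lemma shift_zpow_mul (s t : ℝ) (m k : ℤ) :
    shift γ (.ofAdd s) ^ m * shift γ (.ofAdd t) ^ k = shift γ (.ofAdd (m * s + k * t)) := by
  rw [← map_zpow (shift γ), ← map_zpow (shift γ), ← map_mul (shift γ), ← ofAdd_zsmul,
    ← ofAdd_zsmul, ← ofAdd_add, zsmul_eq_mul, zsmul_eq_mul]

lemma shift_zpow (s : ℝ) (m : ℤ) :
    shift γ (.ofAdd s) ^ m = shift γ (.ofAdd (m * s)) := by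
  simpa using shift_zpow_mul γ s 0 m 0

lemma shift_comm (s t : ℝ) : Commute (shift γ (.ofAdd s)) (shift γ (.ofAdd t)) := by
  rw [commute_iff_eq, ← map_mul (shift γ), ← map_mul (shift γ), mul_comm]

lemma trigEval_shiftHom (x t : ℝ) (P : MvPolynomial ι ℂ) :
    trigEval γ x (shiftHom γ t P) = trigEval γ (x + t) P := by
  rw [← AlgHom.comp_apply]
  congr 1
  refine algHom_ext fun i => ?_
  simp only [shiftHom, trigEval, aeval_X, AlgHom.comp_apply, map_mul, mul_add, expi_add, algHom_C]
  rw [mul_comm]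
  rfl

lemma shiftHom_ne_zero (t : ℝ) {P : MvPolynomial ι ℂ} (hP : P ≠ 0) : shiftHom γ t P ≠ 0 :=
  mulAut_ne_zero (shift γ (.ofAdd t)) hP

variable [Fintype ι]

lemma coeff_shiftHom (t : ℝ) (n : ι →₀ ℕ) (P : MvPolynomial ι ℂ) :
    coeff n (shiftHom γ t P) = expi (freq γ n * t) * coeff n P := by
  classical
  induction P using MvPolynomial.induction_on' with
  | monomial m a =>
    have h : shiftHom γ t (monomial m a) = monomial m (a * expi (freq γ m * t)) := by
      have e : expi (freq γ m * t) = ∏ i, expi (γ i * t) ^ m i := by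
        rw [freq, Finset.sum_mul, expi_sum]
        simp only [mul_assoc, expi_nat_mul]
      rw [shiftHom, aeval_monomial, Finsupp.prod_fintype _ _ (by simp), e]
      simp only [mul_pow, Finset.prod_mul_distrib, algebraMap_eq, ← map_pow, ← map_prod]
      rw [monomial_eq, C_mul, mul_assoc, Finsupp.prod_fintype _ _ (by simp)]
    rw [h, coeff_monomial, coeff_monomial]
    split_ifs with hm
    · rw [hm, mul_comm]
    · simp
  | add p q hp hq => rw [map_add, coeff_add, coeff_add, hp, hq, mul_add]

/-- Units are constants, so the shift multiplies all coefficients of P by the same number, whereas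
it multiplies the coefficient at n by the character of `freq γ n` at t. -/
lemma exists_eq_int_of_associated_shift {t : ℝ} {P : MvPolynomial ι ℂ}
    (h : Associated (shift γ (.ofAdd t) P) P) {n m : ι →₀ ℕ} (hn : n ∈ P.support)
    (hm : m ∈ P.support) : ∃ k : ℤ, (freq γ n - freq γ m) * t = k := by
  obtain ⟨u, hu⟩ := h.symm
  obtain ⟨c, hc, hcu⟩ := MvPolynomial.isUnit_iff_eq_C_of_isReduced.mp u.isUnit
  have key : ∀ n ∈ P.support, expi (freq γ n * t) = c := by
    intro n hn
    have h1 := congrArg (coeff n) hu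
    rw [shift_apply, coeff_shiftHom, hcu, mul_comm P, coeff_C_mul] at h1
    exact (mul_right_cancel₀ (mem_support_iff.mp hn) h1).symm
  rw [← expi_eq_one_iff, sub_mul, expi_sub, key n hn, key m hm, div_self hc.ne_zero]

variable {γ}

lemma freq_injective (hγ : LinearIndependent ℤ γ) : Function.Injective (freq γ) := by
  intro n m h
  ext i
  have := Fintype.linearIndependent_iff.mp hγ (fun i => (n i : ℤ) - m i) (by
    simp only [zsmul_eq_mul]
    push_cast
    simp only [sub_mul, Finset.sum_sub_distrib]
    exact sub_eq_zero.mpr h) i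
  omega

/-- Independence of the γ i makes distinct monomials into distinct characters, which are linearly
independent. -/
lemma exists_trigEval_ne_zero (hγ : LinearIndependent ℤ γ) {P : MvPolynomial ι ℂ} (hP : P ≠ 0) :
    ∃ x, trigEval γ x P ≠ 0 := by
  by_contra! hcon
  let χ : (ι →₀ ℕ) → (Multiplicative ℝ →* ℂ) := fun n =>
    { toFun := fun x => expi (freq γ n * x.toAdd)
      map_one' := by simp [expi_zero]
      map_mul' := fun x y => by simp [mul_add, expi_add] }
  have hχ : Function.Injective χ := by
    intro n m hnm
    by_contra hne
    have hd : freq γ n - freq γ m ≠ 0 := sub_ne_zero.mpr fun h => hne (freq_injective hγ h)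
    -- At this point the two characters differ by the factor e(1/2) = -1.
    have h1 : expi (freq γ n * (1 / (2 * (freq γ n - freq γ m))))
        = expi (freq γ m * (1 / (2 * (freq γ n - freq γ m)))) :=
      DFunLike.congr_fun hnm (Multiplicative.ofAdd (1 / (2 * (freq γ n - freq γ m))))
    have h2 : expi (1 / 2) = 1 := by
      have e : (1 / 2 : ℝ) = freq γ n * (1 / (2 * (freq γ n - freq γ m)))
          - freq γ m * (1 / (2 * (freq γ n - freq γ m))) := by
        rw [← sub_mul]; field_simp
      rw [e, expi_sub, h1, div_self (expi_ne_zero _)]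
    obtain ⟨k, hk⟩ := expi_eq_one_iff.mp h2
    have : (1 : ℤ) = 2 * k := by
      have : (1 : ℝ) = 2 * k := by linarith
      exact_mod_cast this
    omega
  have hli := (linearIndependent_monoidHom (Multiplicative ℝ) ℂ).comp χ hχ
  rw [linearIndependent_iff'] at hli
  refine hP (MvPolynomial.ext _ _ fun n => ?_)
  by_cases hn : n ∈ P.support
  · refine hli P.support (fun n => coeff n P) ?_ n hn
    funext x
    have := hcon x.toAdd
    rw [trigEval_eq_sum] at this
    simpa [χ, Finset.sum_apply] using this
  · simpa using hn

/-- The zeros of a nonzero real-analytic function on the line form a discrete, hence null, set. -/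
lemma ae_trigEval_ne_zero (hγ : LinearIndependent ℤ γ) {P : MvPolynomial ι ℂ} (hP : P ≠ 0) :
    ∀ᵐ x, trigEval γ x P ≠ 0 := by
  obtain ⟨x₀, hx₀⟩ := exists_trigEval_ne_zero hγ hP
  have han : AnalyticOnNhd ℝ (fun x => trigEval γ x P) Set.univ := by
    intro x _
    simp only [trigEval_eq_sum]
    refine Finset.analyticAt_fun_sum _ fun n _ => analyticAt_const.mul ?_
    have e : (fun x : ℝ => expi (freq γ n * x))
        = Complex.exp ∘ fun x : ℝ => (2 * Real.pi * freq γ n * Complex.I) * Complex.ofRealCLM x := by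
      funext x
      simp only [expi, Complex.ofRealCLM_apply, Function.comp]
      congr 1; push_cast; ring
    rw [e]
    exact (analyticAt_cexp.restrictScalars (𝕜 := ℝ)).comp
      (analyticAt_const.mul (Complex.ofRealCLM.analyticAt x))
  have hcod := han.preimage_zero_mem_codiscrete hx₀
  have hle := ae_restrict_le_codiscreteWithin (μ := (volume : Measure ℝ)) MeasurableSet.univ
  rw [Measure.restrict_univ] at hle
  filter_upwards [hle hcod] with x hx
  simpa using hx

end TrigonometricPolynomials

/-! ### Decay of translates against tight cocycles -/

section Cocycle

/-- Over one period, the integral of ∑ |g(x + nδ)|² is the squared norm of g, so the series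
converges almost everywhere. -/
lemma ae_tendsto_translates_of_pos {g : ℝ → ℂ} (hg : MemLp g 2 volume) {δ : ℝ} (hδ : 0 < δ) :
    ∀ᵐ x, Tendsto (fun n : ℤ => g (x + n * δ)) cofinite (𝓝 0) := by
  set f : ℝ → ℝ≥0∞ := fun x => ‖g x‖ₑ ^ (2 : ℝ) with hf
  have hfm : AEMeasurable f volume := hg.1.enorm.pow_const 2
  have hfin : ∫⁻ x, f x ≠ ⊤ := by
    have := (lintegral_rpow_enorm_lt_top_of_eLpNorm_lt_top two_ne_zero ENNReal.ofNat_ne_top hg.2).ne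
    simpa [hf] using this
  have hstrip : ∀ m : ℤ, ∀ᵐ x, x ∈ Set.Ioc (0 + m • δ) (0 + (m + 1) • δ) →
      Tendsto (fun n : ℤ => g (x + n * δ)) cofinite (𝓝 0) := by
    intro m
    rw [← ae_restrict_iff' measurableSet_Ioc]
    have hsum : ∫⁻ x in Set.Ioc (0 + m • δ) (0 + (m + 1) • δ), ∑' n : ℤ, f (x + n * δ) ≠ ⊤ := by
      rw [lintegral_tsum]
      · have h1 : ∀ n : ℤ, ∫⁻ x in Set.Ioc (0 + m • δ) (0 + (m + 1) • δ), f (x + n * δ)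
            = ∫⁻ x in Set.Ioc (m • δ + n • δ) (m • δ + (n + 1) • δ), f x := by
          intro n
          have h := (measurePreserving_add_right volume (n * δ)).setLIntegral_comp_preimage_emb
            (measurableEmbedding_addRight _) f
            (Set.Ioc (m • δ + n • δ) (m • δ + (n + 1) • δ))
          rw [← h, Set.preimage_add_const_Ioc]
          congr 3
          · simp
          · simp; ring
        simp only [h1]
        rw [← lintegral_iUnion (fun _ => measurableSet_Ioc)
          (Set.pairwise_disjoint_Ioc_add_zsmul (m • δ) δ)]
        exact ne_top_of_le_ne_top hfin (setLIntegral_le_lintegral _ _)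
      · intro n
        exact (hfm.comp_quasiMeasurePreserving
          (measurePreserving_add_right volume (n * δ)).quasiMeasurePreserving).restrict
    have hmeas : AEMeasurable (fun x => ∑' n : ℤ, f (x + n * δ))
        (volume.restrict (Set.Ioc (0 + m • δ) (0 + (m + 1) • δ))) :=
      AEMeasurable.tsum fun n => (hfm.comp_quasiMeasurePreserving
          (measurePreserving_add_right volume (n * δ)).quasiMeasurePreserving).restrict
    filter_upwards [ae_lt_top' hmeas hsum] with x hx
    have h2 := ENNReal.tendsto_cofinite_zero_of_tsum_ne_top hx.ne
    rw [tendsto_zero_iff_norm_tendsto_zero]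
    have h3 := (ENNReal.continuous_rpow_const (y := 1 / 2)).tendsto 0 |>.comp h2
    have h4 := (ENNReal.tendsto_toReal (a := (0 : ℝ≥0∞) ^ (1 / 2 : ℝ)) (by simp)).comp h3
    refine (h4.congr fun n => ?_).trans (by simp)
    simp only [hf, Function.comp]
    rw [← ENNReal.rpow_mul]
    norm_num
  filter_upwards [ae_all_iff.mpr hstrip] with x hx
  have : x ∈ ⋃ n : ℤ, Set.Ioc (0 + n • δ) (0 + (n + 1) • δ) := by
    rw [iUnion_Ioc_add_zsmul hδ]; trivial
  obtain ⟨m, hm⟩ := Set.mem_iUnion.mp this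
  exact hx m hm

lemma ae_tendsto_translates {g : ℝ → ℂ} (hg : MemLp g 2 volume) {δ : ℝ} (hδ : δ ≠ 0) :
    ∀ᵐ x, Tendsto (fun n : ℤ => g (x + n * δ)) cofinite (𝓝 0) := by
  rcases hδ.lt_or_gt with h | h
  · filter_upwards [ae_tendsto_translates_of_pos hg (neg_pos.mpr h)] with x hx
    have := hx.comp (neg_injective (G := ℤ)).tendsto_cofinite
    simpa [Function.comp_def] using this
  · exact ae_tendsto_translates_of_pos hg h

lemma not_isTight_of_tendsto_atTop {U : ℕ → ℝ → ℝ} {S : Set ℝ} (hS : volume S ≠ 0)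
    (h : ∀ᵐ x, x ∈ S → Tendsto (fun k => U k x) atTop atTop) : ¬ IsTight U := by
  intro hU
  obtain ⟨n, hn⟩ : ∃ n : ℕ, volume (S ∩ Set.Icc (-n : ℝ) n) ≠ 0 := by
    by_contra! hcon
    refine hS (measure_mono_null ?_ (measure_iUnion_null hcon))
    intro x hx
    obtain ⟨n, hn⟩ := exists_nat_ge |x|
    exact Set.mem_iUnion.mpr ⟨n, hx, abs_le.mp hn⟩
  set V := volume (S ∩ Set.Icc (-n : ℝ) n) with hV
  have hVtop : V ≠ ⊤ := ne_top_of_le_ne_top (by simp) (measure_mono Set.inter_subset_right)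
  have hVpos : 0 < V.toReal := ENNReal.toReal_pos hn hVtop
  obtain ⟨L, hL⟩ := hU n (V.toReal / 2) (by positivity)
  let a : ℕ → Set ℝ := fun m => {x | x ∈ Set.Icc (-n : ℝ) n ∧ ∀ k ≥ m, L < |U k x|}
  have hmono : Monotone a := fun i j hij x hx => ⟨hx.1, fun k hk => hx.2 k (hij.trans hk)⟩
  have h1 : V ≤ volume (⋃ m, a m) := by
    refine measure_mono_ae ?_
    filter_upwards [h] with x hx
    rintro ⟨hxS, hxI⟩
    obtain ⟨m, hm⟩ := eventually_atTop.mp ((hx hxS).eventually_gt_atTop L)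
    exact Set.mem_iUnion.mpr ⟨m, hxI, fun k hk => (hm k hk).trans_le (le_abs_self _)⟩
  rw [hmono.measure_iUnion] at h1
  have h2 : V ≤ ENNReal.ofReal (V.toReal / 2) :=
    h1.trans (iSup_le fun m => le_trans (measure_mono (t := {x | x ∈ Set.Icc (-n : ℝ) n ∧ L < |U m x|})
      fun x hx => ⟨hx.1, hx.2 m le_rfl⟩) (hL m))
  rw [ENNReal.le_ofReal_iff_toReal_le hVtop (by positivity)] at h2
  linarith

/-- A square-integrable function cannot be multiplied, under translation by `δ`, by a quotient of
tight factors, even after a recurrent change of gauge `W`. -/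
theorem false_of_tight_cocycle {g : ℝ → ℂ} (hg : MemLp g 2 volume) (hg0 : ¬ g =ᵐ[volume] 0)
    {δ : ℝ} (hδ : δ ≠ 0) {N : ℕ → ℕ} (hN : Tendsto N atTop atTop) {W : ℝ → ℝ}
    (hW : ∀ᵐ x, W x ≠ 0) (hWadd : ∀ᵐ x, Tendsto (fun k => W (x + N k * δ)) atTop (𝓝 (W x)))
    (hWsub : ∀ᵐ x, Tendsto (fun k => W (x - N k * δ)) atTop (𝓝 (W x)))
    {e₁ e₂ : ℝ → ℝ} (h₁ : TightFactor δ N e₁) (h₂ : TightFactor δ N e₂) {c : ℝ} (hc : c ≠ 0)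
    (hrel : ∀ᵐ x, e₂ x * (‖g (x + δ)‖ * W (x + δ)) = c * e₁ x * (‖g x‖ * W x)) : False := by
  set G : ℝ → ℝ := fun x => ‖g x‖ * W x with hG
  let good : ℝ → Prop := fun x => W x ≠ 0 ∧ e₁ x ≠ 0 ∧ e₂ x ≠ 0 ∧
    e₂ x * G (x + δ) = c * e₁ x * G x
  have hgood : ∀ᵐ x, ∀ n : ℤ, good (x + n * δ) := ae_all_iff.mpr fun n =>
    ae_comp_add (by filter_upwards [hW, h₁.1, h₂.1, hrel] with x a1 a2 a3 a4
                      using ⟨a1, a2, a3, a4⟩) (n * δ)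
  have hfwd : ∀ x, (∀ n : ℤ, good (x + n * δ)) → G x ≠ 0 → ∀ n : ℕ, G (x + n * δ) ≠ 0 ∧
      Real.log (G (x + n * δ)) = Real.log (G x) + n * Real.log c +
        ∑ j ∈ Finset.range n, (Real.log (e₁ (x + j * δ)) - Real.log (e₂ (x + j * δ))) := by
    intro x hx hGx n
    induction n with
    | zero => simpa using hGx
    | succ n ih =>
      obtain ⟨-, b1, b2, b3⟩ := hx n
      push_cast at b1 b2 b3
      have e : x + n * δ + δ = x + (n + 1 : ℕ) * δ := by push_cast; ring
      rw [e] at b3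
      have hne : G (x + (n + 1 : ℕ) * δ) ≠ 0 := by
        intro h0
        rw [h0, mul_zero] at b3
        exact mul_ne_zero (mul_ne_zero hc b1) ih.1 b3.symm
      refine ⟨hne, ?_⟩
      have hl := congrArg Real.log b3
      rw [Real.log_mul b2 hne, Real.log_mul (mul_ne_zero hc b1) ih.1, Real.log_mul hc b1, ih.2] at hl
      rw [Finset.sum_range_succ]
      push_cast
      push_cast at hl
      linarith
  have hbwd : ∀ x, (∀ n : ℤ, good (x + n * δ)) → G x ≠ 0 → ∀ n : ℕ, G (x - n * δ) ≠ 0 := by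
    intro x hx hGx n
    induction n with
    | zero => simpa using hGx
    | succ n ih =>
      obtain ⟨-, b1, b2, b3⟩ := hx (-(n + 1 : ℕ))
      have e : x + ((-(n + 1 : ℕ) : ℤ) : ℝ) * δ + δ = x - n * δ := by push_cast; ring
      have e' : x + ((-(n + 1 : ℕ) : ℤ) : ℝ) * δ = x - (n + 1 : ℕ) * δ := by push_cast; ring
      rw [e, e'] at b3
      rw [e'] at b2
      intro h0
      rw [h0, mul_zero] at b3
      exact mul_ne_zero b2 ih b3
  -- The tight sequence is log of G(x)² / (G(x + Nδ) G(x - Nδ)), as the powers of c in the two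
  -- N-step products cancel. It tends to infinity where g ≠ 0.
  have htight := h₁.2.add h₂.2.neg
  refine not_isTight_of_tendsto_atTop (S := {x | g x ≠ 0}) hg0 ?_ htight
  filter_upwards [hgood, hWadd, hWsub, ae_tendsto_translates hg hδ] with x hx hxadd hxsub hxg hgx
  have hWx : W x ≠ 0 := by simpa using (hx 0).1
  have hGx : G x ≠ 0 := mul_ne_zero (norm_ne_zero_iff.mpr hgx) hWx
  have hcof : Tendsto (fun k => (N k : ℤ)) atTop cofinite :=
    (Nat.cast_injective (R := ℤ)).tendsto_cofinite.comp (Nat.cofinite_eq_atTop ▸ hN)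
  have hcof' : Tendsto (fun k => -(N k : ℤ)) atTop cofinite :=
    neg_injective.tendsto_cofinite.comp hcof
  have hlim : ∀ s : ℕ → ℝ, Tendsto (fun k => G (s k)) atTop (𝓝 0) → (∀ k, G (s k) ≠ 0) →
      Tendsto (fun k => Real.log (G (s k))) atTop atBot := fun s hs hne =>
    Real.tendsto_log_nhdsNE_zero.comp
      (tendsto_nhdsWithin_iff.mpr ⟨hs, Eventually.of_forall hne⟩)
  have hadd := hlim (fun k => x + N k * δ) (by
    have := (hxg.comp hcof).norm.mul hxadd
    simpa [hG, Function.comp_def] using this) (fun k => (hfwd x hx hGx _).1)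
  have hsub := hlim (fun k => x - N k * δ) (by
    have := (hxg.comp hcof').norm.mul hxsub
    simpa [hG, Function.comp_def, ← sub_eq_add_neg] using this) (fun k => hbwd x hx hGx _)
  have hfinal : Tendsto (fun k => 2 * Real.log (G x) + -(Real.log (G (x + N k * δ)) +
      Real.log (G (x - N k * δ)))) atTop atTop :=
    tendsto_atTop_add_const_left _ _ (tendsto_neg_atBot_atTop.comp (hadd.atBot_add_atBot hsub))
  refine hfinal.congr fun k => ?_
  have f1 := (hfwd x hx hGx (N k)).2
  have hx' : ∀ n : ℤ, good (x - N k * δ + n * δ) := fun n => by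
    have := hx (n - N k)
    have e : x + ((n - N k : ℤ) : ℝ) * δ = x - N k * δ + n * δ := by push_cast; ring
    rwa [e] at this
  have f2 := (hfwd (x - N k * δ) hx' (hbwd x hx hGx _) (N k)).2
  rw [sub_add_cancel] at f2
  simp only [logShift, Finset.sum_sub_distrib] at f1 f2 ⊢
  have e : ∀ j : ℕ, x - N k * δ + j * δ = x + j * δ - N k * δ := fun j => by ring
  simp only [e] at f2
  linarith

end Cocycle

/-! ### From shift relations to a tight cocycle -/

section ShiftRelations

open MvPolynomial

variable {ι : Type*} {γ : ι → ℝ}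

/-- Modulo multiples of `δ₁`, every element of the group generated by `γ` has a nonzero multiple
that fixes `p` up to associates. -/
def Exceptional (γ : ι → ℝ) (δ₁ : ℝ) (p : MvPolynomial ι ℂ) : Prop :=
  ∀ δ₂ ∈ Submodule.span ℤ (Set.range γ), ∃ m : ℤ, m ≠ 0 ∧ ∃ k : ℤ,
    Associated (shift γ (.ofAdd (m * δ₂ + k * δ₁)) p) p

/-- Shifts commute, so members of one row are fixed by the same shifts up to associates. -/
lemma exceptional_of_inRow {δ₁ : ℝ} {p q : MvPolynomial ι ℂ}
    (h : InRow (shift γ (.ofAdd δ₁)) p q) : Exceptional γ δ₁ p ↔ Exceptional γ δ₁ q := by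
  obtain ⟨j, hj⟩ := h
  refine forall₂_congr fun δ₂ _ => exists_congr fun m => and_congr_right fun _ =>
    exists_congr fun k => ?_
  set s := m * δ₂ + k * δ₁
  rw [shift_zpow] at hj
  have hc : ∀ P : MvPolynomial ι ℂ, shift γ (.ofAdd s) (shift γ (.ofAdd (j * δ₁)) P)
      = shift γ (.ofAdd (j * δ₁)) (shift γ (.ofAdd s) P) := fun P => by
    rw [← MulAut.mul_apply, (shift_comm γ s (j * δ₁)).eq, MulAut.mul_apply]
  constructor
  · intro h
    refine (mulAut_associated (shift γ (.ofAdd s)) hj).symm.trans (Associated.trans ?_ hj)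
    rw [hc]
    exact mulAut_associated _ h
  · intro h
    have h1 := ((mulAut_associated (shift γ (.ofAdd s)) hj).trans h).trans hj.symm
    rw [hc] at h1
    have h2 := mulAut_associated (shift γ (.ofAdd (j * δ₁)))⁻¹ h1
    simpa using h2

lemma tendsto_trigEval_add {t : ℕ → ℝ}
    (ht : ∀ i, Tendsto (fun k => expi (γ i * t k)) atTop (𝓝 1)) (P : MvPolynomial ι ℂ) (x : ℝ) :
    Tendsto (fun k => trigEval γ (x + t k) P) atTop (𝓝 (trigEval γ x P)) := by
  have h : Tendsto (fun k i => expi (γ i * (x + t k))) atTop (𝓝 fun i => expi (γ i * x)) := by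
    refine tendsto_pi_nhds.mpr fun i => ?_
    have := (ht i).const_mul (expi (γ i * x))
    simpa only [mul_add, expi_add, mul_one] using this
  exact ((MvPolynomial.continuous_eval P).tendsto _).comp h

lemma tightFactor_trigEval {δ : ℝ} {N : ℕ → ℕ} {Q : MvPolynomial ι ℂ} (hQ : Q ≠ 0)
    (h : ∀ p, Prime p → p ∣ Q → TightFactor δ N fun x => ‖trigEval γ x p‖) :
    TightFactor δ N fun x => ‖trigEval γ x Q‖ := by
  revert hQ h
  refine UniqueFactorizationMonoid.induction_on_prime (P := fun Q => Q ≠ 0 →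
    (∀ p, Prime p → p ∣ Q → TightFactor δ N fun x => ‖trigEval γ x p‖) →
    TightFactor δ N fun x => ‖trigEval γ x Q‖) Q (fun h => absurd rfl h) ?_ ?_
  · intro u hu _ _
    obtain ⟨c, hc, rfl⟩ := MvPolynomial.isUnit_iff_eq_C_of_isReduced.mp hu
    simpa [trigEval] using tightFactor_const δ N (norm_ne_zero_iff.mpr hc.ne_zero)
  · intro a p ha hp ih _ h
    simp only [map_mul, norm_mul]
    exact (h p hp (dvd_mul_right p a)).mul (ih ha fun q hq hqa => h q hq (hqa.mul_left p))

variable [Fintype ι]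

/-- Both sides arise by computing g(x + δ₁ + δ₂) through δ₁ or δ₂ first. If they differed, their
difference would be nonzero almost everywhere and would annihilate g. -/
lemma shift_commutation (hγ : LinearIndependent ℤ γ) {g : ℝ → ℂ} (hg0 : ¬ g =ᵐ[volume] 0)
    {δ₁ δ₂ : ℝ} {A₁ B₁ A₂ B₂ : MvPolynomial ι ℂ}
    (h₁ : ∀ᵐ x, trigEval γ x B₁ * g (x + δ₁) = trigEval γ x A₁ * g x)
    (h₂ : ∀ᵐ x, trigEval γ x B₂ * g (x + δ₂) = trigEval γ x A₂ * g x) :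
    shiftHom γ δ₁ A₂ * A₁ * (shiftHom γ δ₂ B₁ * B₂)
      = shiftHom γ δ₂ A₁ * A₂ * (shiftHom γ δ₁ B₂ * B₁) := by
  rw [← sub_eq_zero]
  by_contra hne
  refine hg0 ?_
  filter_upwards [ae_trigEval_ne_zero hγ hne, h₁, h₂, ae_comp_add h₁ δ₂, ae_comp_add h₂ δ₁]
    with x hx a1 a2 a3 a4
  simp only [map_sub, map_mul, trigEval_shiftHom] at hx
  rw [show x + δ₁ + δ₂ = x + δ₂ + δ₁ by ring] at a4
  have key : (trigEval γ (x + δ₁) A₂ * trigEval γ x A₁ *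
      (trigEval γ (x + δ₂) B₁ * trigEval γ x B₂) - trigEval γ (x + δ₂) A₁ * trigEval γ x A₂ *
      (trigEval γ (x + δ₁) B₂ * trigEval γ x B₁)) * g x = 0 := by
    linear_combination (-trigEval γ (x + δ₁) A₂ * trigEval γ (x + δ₂) B₁ * trigEval γ x B₂) * a1
      + (trigEval γ (x + δ₂) A₁ * trigEval γ (x + δ₁) B₂ * trigEval γ x B₁) * a2
      + (trigEval γ (x + δ₁) B₂ * trigEval γ x B₁ * trigEval γ x B₂) * a3
      - (trigEval γ (x + δ₂) B₁ * trigEval γ x B₂ * trigEval γ x B₁) * a4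
  exact (mul_eq_zero.mp key).resolve_left hx

/-- Reduces the problem to finding times N along which all characters recur and the exceptional
primes are tight. Nonexceptional primes of A₁/B₁ balance along rows and form a coboundary. -/
theorem false_of_shift_relations (hγ : LinearIndependent ℤ γ) {g : ℝ → ℂ}
    (hg : MemLp g 2 volume) (hg0 : ¬ g =ᵐ[volume] 0)
    (hrel : ∀ δ ∈ Submodule.span ℤ (Set.range γ), ∃ A B : MvPolynomial ι ℂ, A ≠ 0 ∧ B ≠ 0 ∧
      ∀ᵐ x, trigEval γ x B * g (x + δ) = trigEval γ x A * g x)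
    {δ₁ : ℝ} (hδ₁ : δ₁ ∈ Submodule.span ℤ (Set.range γ)) (hδ₁0 : δ₁ ≠ 0)
    {N : ℕ → ℕ} (hN : Tendsto N atTop atTop)
    (hN1 : ∀ i, Tendsto (fun k => expi (γ i * (N k * δ₁))) atTop (𝓝 1))
    (htight : ∀ p, Prime p → Exceptional γ δ₁ p → TightFactor δ₁ N fun x => ‖trigEval γ x p‖) :
    False := by
  obtain ⟨A₁, B₁, hA₁, hB₁, h₁⟩ := hrel δ₁ hδ₁
  have hbal : ∀ p, Prime p → ¬ Exceptional γ δ₁ p →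
      primeCount (InRow (shift γ (.ofAdd δ₁)) p) A₁
        = primeCount (InRow (shift γ (.ofAdd δ₁)) p) B₁ := by
    intro p _ hp
    simp only [Exceptional] at hp
    push Not at hp
    obtain ⟨δ₂, hδ₂, hp⟩ := hp
    obtain ⟨A₂, B₂, hA₂, hB₂, h₂⟩ := hrel δ₂ hδ₂
    refine primeCount_row_eq (shift_comm γ δ₁ δ₂) hA₁ hB₁ hA₂ hB₂
      (Associated.of_eq (shift_commutation hγ hg0 h₁ h₂)) fun m hm k => ?_
    rw [shift_zpow_mul]
    exact hp m hm k
  obtain ⟨H, K, E₁, E₂, hH, hK, hE₁, hE₂, hp₁, hp₂, u, hu⟩ :=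
    exists_coboundary (fun p q => exceptional_of_inRow) hA₁ hB₁ hbal
  obtain ⟨c, hc, hcu⟩ := MvPolynomial.isUnit_iff_eq_C_of_isReduced.mp u.isUnit
  have hc0 := hc.ne_zero
  rw [hcu] at hu
  have hN1' : ∀ i, Tendsto (fun k => expi (γ i * (-(N k * δ₁)))) atTop (𝓝 1) := fun i => by
    have := (hN1 i).inv₀ one_ne_zero
    simpa only [mul_neg, expi_neg, inv_one] using this
  have hHae := ae_trigEval_ne_zero hγ hH
  have hKae := ae_trigEval_ne_zero hγ hK
  -- The gauge |K/H| absorbs the coboundary and recurs because the characters do; only E₁/E₂ and a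
  -- constant remain.
  refine false_of_tight_cocycle hg hg0 hδ₁0 hN
    (W := fun x => ‖trigEval γ x K‖ / ‖trigEval γ x H‖) (c := ‖c‖⁻¹) ?_ ?_ ?_
    (tightFactor_trigEval hE₁ fun p hp hd => htight p hp (hp₁ p hp hd))
    (tightFactor_trigEval hE₂ fun p hp hd => htight p hp (hp₂ p hp hd))
    (inv_ne_zero (norm_ne_zero_iff.mpr hc0)) ?_
  · filter_upwards [hHae, hKae] with x hx1 hx2
    exact div_ne_zero (norm_ne_zero_iff.mpr hx2) (norm_ne_zero_iff.mpr hx1)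
  · filter_upwards [hHae] with x hx
    exact (tendsto_trigEval_add hN1 K x).norm.div (tendsto_trigEval_add hN1 H x).norm
      (norm_ne_zero_iff.mpr hx)
  · filter_upwards [hHae] with x hx
    simp only [sub_eq_add_neg]
    exact (tendsto_trigEval_add hN1' K x).norm.div (tendsto_trigEval_add hN1' H x).norm
      (norm_ne_zero_iff.mpr hx)
  · filter_upwards [hHae, hKae, ae_comp_add hHae δ₁, ae_comp_add hKae δ₁, h₁,
      ae_trigEval_ne_zero hγ hB₁] with x a1 a2 a3 a4 a5 a6
    have hev := congrArg (trigEval γ x) hu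
    have hC : trigEval γ x (C c) = c := by simp [trigEval]
    simp only [shift_apply, map_mul, trigEval_shiftHom, hC] at hev
    have key : c * (trigEval γ x E₂ * g (x + δ₁) * trigEval γ (x + δ₁) K * trigEval γ x H)
        = trigEval γ x E₁ * g x * trigEval γ x K * trigEval γ (x + δ₁) H := by
      refine mul_left_cancel₀ a6 ?_
      linear_combination (c * trigEval γ x E₂ * trigEval γ (x + δ₁) K * trigEval γ x H) * a5
        + g x * hev
    have hn := congrArg (fun z : ℂ => ‖z‖) key
    simp only [norm_mul] at hn
    have b0 := norm_ne_zero_iff.mpr hc0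
    have b1 := norm_ne_zero_iff.mpr a1
    have b3 := norm_ne_zero_iff.mpr a3
    field_simp
    linarith

end ShiftRelations

/-! ### Diophantine approximation and resonance -/

section Arithmetic

open MvPolynomial

/-- Multiplication by s embeds {β ∈ Δ : βs ∈ ℤ} in ℤ, so this group is cyclic. When it is trivial, δ
serves as a nonzero γ₀. -/
lemma exists_generator_of_integral_multiples (Δ : Submodule ℤ ℝ) {δ s : ℝ} (hδ : δ ∈ Δ)
    (hδ0 : δ ≠ 0) (hs : s ≠ 0) :
    ∃ γ₀ ∈ Δ, γ₀ ≠ 0 ∧ ∀ β ∈ Δ, (∃ k : ℤ, β * s = k) → ∃ j : ℤ, β = j * γ₀ := by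
  let Z : Submodule ℤ ℤ :=
    { carrier := {k | ∃ β ∈ Δ, β * s = k}
      add_mem' := by
        rintro a b ⟨β, hβ, h1⟩ ⟨β', hβ', h2⟩
        exact ⟨β + β', Δ.add_mem hβ hβ', by push_cast; rw [add_mul, h1, h2]⟩
      zero_mem' := ⟨0, Δ.zero_mem, by simp⟩
      smul_mem' := by
        rintro c a ⟨β, hβ, h1⟩
        refine ⟨c • β, Δ.smul_mem c hβ, ?_⟩
        simp only [zsmul_eq_mul, smul_eq_mul, Int.cast_mul, mul_assoc, h1] }
  obtain ⟨d, hd⟩ := (IsPrincipalIdealRing.principal Z).principal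
  have hmem : ∀ β ∈ Δ, ∀ k : ℤ, β * s = k → ∃ j : ℤ, k = j * d := by
    intro β hβ k hk
    have : k ∈ Z := ⟨β, hβ, hk⟩
    rw [hd] at this
    obtain ⟨j, hj⟩ := Submodule.mem_span_singleton.mp this
    exact ⟨j, by rw [← hj, smul_eq_mul]⟩
  by_cases hd0 : d = 0
  · refine ⟨δ, hδ, hδ0, ?_⟩
    rintro β hβ ⟨k, hk⟩
    obtain ⟨j, hj⟩ := hmem β hβ k hk
    rw [hj, hd0, mul_zero, Int.cast_zero] at hk
    exact ⟨0, by rw [(mul_eq_zero.mp hk).resolve_right hs]; simp⟩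
  · have : d ∈ Z := by rw [hd]; exact Submodule.mem_span_singleton_self d
    obtain ⟨β₀, hβ₀, h0⟩ := this
    refine ⟨β₀, hβ₀, ?_, ?_⟩
    · rintro rfl
      rw [zero_mul] at h0
      exact hd0 (by exact_mod_cast h0.symm)
    · rintro β hβ ⟨k, hk⟩
      obtain ⟨j, hj⟩ := hmem β hβ k hk
      refine ⟨j, mul_right_cancel₀ hs ?_⟩
      rw [hk, hj, mul_assoc, h0]
      push_cast; rfl

/-- For rational α take multiples of a denominator. Otherwise qα stays a distance η from the
integers for all q ≤ B + 1, so an approximation better than η has a larger q. -/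
lemma exists_arbitrarily_large_dirichlet (α : ℝ) (B : ℕ) :
    ∃ q : ℕ, B ≤ q ∧ 0 < q ∧ ∃ p : ℤ, |q * α - p| ≤ 1 / q := by
  by_cases hrat : ∃ q : ℕ, 0 < q ∧ ∃ p : ℤ, q * α = p
  · obtain ⟨q, hq, p, hp⟩ := hrat
    refine ⟨q * (B + 1), by nlinarith, by positivity, p * (B + 1 : ℕ), ?_⟩
    have : ((q * (B + 1) : ℕ) : ℝ) * α - ((p * (B + 1 : ℕ) : ℤ) : ℝ) = 0 := by
      push_cast; rw [← hp]; ring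
    rw [this, abs_zero]; positivity
  · push Not at hrat
    obtain ⟨η, hη, hle⟩ : ∃ η : ℝ, 0 < η ∧ ∀ q ∈ Finset.Icc 1 (B + 1), η ≤ |q * α - round (q * α)| := by
      obtain ⟨q, hq, hmin⟩ := Finset.exists_min_image (Finset.Icc 1 (B + 1))
        (fun q : ℕ => |q * α - round (q * α)|) ⟨1, by simp⟩
      exact ⟨_, abs_pos.mpr (sub_ne_zero.mpr (hrat q (Finset.mem_Icc.mp hq).1 _)), hmin⟩
    obtain ⟨n, hn⟩ := exists_nat_one_div_lt hη
    obtain ⟨q, hq0, hqn, hq⟩ := Real.exists_nat_abs_mul_sub_round_le α (n := n + 1) n.succ_pos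
    have h1 : (1 : ℝ) / ((n + 1 : ℕ) + 1) ≤ 1 / (n + 1) := by
      apply one_div_le_one_div_of_le <;> push_cast <;> [positivity; linarith]
    refine ⟨q, ?_, hq0, round (q * α), hq.trans ?_⟩
    · by_contra hlt
      have := hle q (Finset.mem_Icc.mpr ⟨hq0, by omega⟩)
      linarith
    · apply one_div_le_one_div_of_le (by positivity)
      have : (q : ℝ) ≤ (n + 1 : ℕ) := by exact_mod_cast hqn
      linarith

lemma exists_dirichlet_seq (α : ℝ) :
    ∃ q : ℕ → ℕ, Tendsto q atTop atTop ∧ (∀ k, 0 < q k) ∧ ∀ k, ∃ p : ℤ, |q k * α - p| ≤ 1 / q k := by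
  choose q h1 h2 h3 using exists_arbitrarily_large_dirichlet α
  exact ⟨q, tendsto_atTop_mono h1 tendsto_id, h2, h3⟩

variable {ι : Type*} {γ : ι → ℝ}

lemma exists_approx_of_mem_span {N : ℕ → ℕ} {δ : ℝ}
    (h : ∀ i, ∃ C : ℝ, 0 ≤ C ∧ ∀ k, ∃ p : ℤ, |N k * (γ i * δ) - p| ≤ C / N k) {β : ℝ}
    (hβ : β ∈ Submodule.span ℤ (Set.range γ)) :
    ∃ C : ℝ, 0 ≤ C ∧ ∀ k, ∃ p : ℤ, |N k * (β * δ) - p| ≤ C / N k := by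
  induction hβ using Submodule.span_induction with
  | mem x hx => obtain ⟨i, rfl⟩ := hx; exact h i
  | zero => exact ⟨0, le_rfl, fun k => ⟨0, by simp⟩⟩
  | add x y _ _ hx hy =>
    obtain ⟨C, hC, hx⟩ := hx
    obtain ⟨C', hC', hy⟩ := hy
    refine ⟨C + C', by positivity, fun k => ?_⟩
    obtain ⟨p, hp⟩ := hx k
    obtain ⟨p', hp'⟩ := hy k
    refine ⟨p + p', ?_⟩
    have e : N k * ((x + y) * δ) - ((p + p' : ℤ) : ℝ)
        = (N k * (x * δ) - p) + (N k * (y * δ) - p') := by push_cast; ring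
    rw [e, add_div]
    exact (abs_add_le _ _).trans (add_le_add hp hp')
  | smul c x _ hx =>
    obtain ⟨C, hC, hx⟩ := hx
    refine ⟨|(c : ℝ)| * C, by positivity, fun k => ?_⟩
    obtain ⟨p, hp⟩ := hx k
    refine ⟨c * p, ?_⟩
    have e : N k * ((c • x) * δ) - ((c * p : ℤ) : ℝ) = c * (N k * (x * δ) - p) := by
      rw [zsmul_eq_mul]; push_cast; ring
    rw [e, abs_mul, mul_div_assoc]
    gcongr

variable [Fintype ι]

lemma freq_mem_span (n : ι →₀ ℕ) : freq γ n ∈ Submodule.span ℤ (Set.range γ) := by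
  refine Submodule.sum_mem _ fun i _ => ?_
  have := Submodule.smul_mem (Submodule.span ℤ (Set.range γ)) (n i : ℤ)
    (Submodule.subset_span (Set.mem_range_self i))
  simpa using this

/-- Dividing by a unimodular character leaves only nonnegative multiples of γ₀ as frequencies. -/
lemma exists_polynomial_norm_trigEval (hγ : LinearIndependent ℤ γ) {P : MvPolynomial ι ℂ}
    (hP : P ≠ 0) {γ₀ : ℝ}
    (h : ∀ n ∈ P.support, ∀ m ∈ P.support, ∃ j : ℤ, freq γ n - freq γ m = j * γ₀) :
    ∃ q : Polynomial ℂ, q ≠ 0 ∧ ∀ x, ‖trigEval γ x P‖ = ‖q.eval (expi (γ₀ * x))‖ := by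
  classical
  obtain ⟨m, hm⟩ := MvPolynomial.support_nonempty.mpr hP
  choose! j hj using fun n hn => h n hn m hm
  obtain ⟨M, hM⟩ : ∃ M : ℕ, ∀ n ∈ P.support, (j n).natAbs ≤ M :=
    ⟨P.support.sup fun n => (j n).natAbs, fun n hn =>
      Finset.le_sup (f := fun n => (j n).natAbs) hn⟩
  let q : Polynomial ℂ := ∑ n ∈ P.support, Polynomial.C (coeff n P) * Polynomial.X ^ (j n + M).toNat
  have hq : ∀ x, trigEval γ x P = expi ((freq γ m - M * γ₀) * x) * q.eval (expi (γ₀ * x)) := by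
    intro x
    rw [trigEval_eq_sum, Polynomial.eval_finsetSum, Finset.mul_sum]
    refine Finset.sum_congr rfl fun n hn => ?_
    rw [Polynomial.eval_mul, Polynomial.eval_C, Polynomial.eval_pow, Polynomial.eval_X,
      ← expi_nat_mul, mul_left_comm, ← expi_add]
    congr 2
    have h1 : (((j n + M).toNat : ℤ) : ℝ) = ((j n + M : ℤ) : ℝ) := by
      rw [Int.toNat_of_nonneg]
      have := hM n hn
      omega
    have h2 := hj n hn
    rw [Int.cast_natCast] at h1
    rw [h1]
    push_cast
    linear_combination x * h2
  refine ⟨q, ?_, fun x => by rw [hq, norm_mul, norm_expi, one_mul]⟩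
  rintro h0
  obtain ⟨x, hx⟩ := exists_trigEval_ne_zero hγ hP
  exact hx (by rw [hq, h0]; simp)

lemma tendsto_expi_of_approx {N : ℕ → ℕ} (hN : Tendsto N atTop atTop) {γ₀ δ C : ℝ}
    (h : ∀ k, ∃ p : ℤ, |N k * (γ₀ * δ) - p| ≤ C / N k) :
    Tendsto (fun k => expi (γ₀ * (N k * δ))) atTop (𝓝 1) := by
  choose p hp using h
  have hlim : Tendsto (fun k => C / (N k : ℝ)) atTop (𝓝 0) :=
    tendsto_const_nhds.div_atTop (tendsto_natCast_atTop_atTop.comp hN)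
  have h0 : Tendsto (fun k => N k * (γ₀ * δ) - p k) atTop (𝓝 0) := squeeze_zero_norm hp hlim
  have := (continuous_expi.tendsto 0).comp h0
  rw [expi_zero] at this
  refine this.congr fun k => ?_
  rw [Function.comp_apply, expi_sub, expi_int, div_one]
  congr 1; ring

/-- The resonant case: the products of the frequencies with `δ` generate a group of rank at most
two containing a nonzero rational. -/
theorem false_of_resonant (hγ : LinearIndependent ℤ γ) {g : ℝ → ℂ}
    (hg : MemLp g 2 volume) (hg0 : ¬ g =ᵐ[volume] 0)
    (hrel : ∀ δ ∈ Submodule.span ℤ (Set.range γ), ∃ A B : MvPolynomial ι ℂ, A ≠ 0 ∧ B ≠ 0 ∧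
      ∀ᵐ x, trigEval γ x B * g (x + δ) = trigEval γ x A * g x)
    {δ : ℝ} (hδ : δ ∈ Submodule.span ℤ (Set.range γ)) (hδ0 : δ ≠ 0) {α : ℝ} {M : ℤ} (hM : M ≠ 0)
    (hα : ∀ i, ∃ a b : ℤ, M * (γ i * δ) = a + b * α)
    (hex : ∀ p, Prime p → Exceptional γ δ p → ∃ s : ℝ, s ≠ 0 ∧
      ∀ n ∈ p.support, ∀ m ∈ p.support, ∃ k : ℤ, (freq γ n - freq γ m) * s = k) : False := by
  obtain ⟨q, hq, hq0, hqα⟩ := exists_dirichlet_seq α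
  have hM0 : 0 < M.natAbs := Int.natAbs_pos.mpr hM
  -- Multiplying the Dirichlet denominators of α by |M| clears the denominators of the γ i δ, so one
  -- sequence approximates all of them at rate O(1/N).
  set N : ℕ → ℕ := fun k => M.natAbs * q k with hNdef
  have hN0 : ∀ k, 0 < N k := fun k => Nat.mul_pos hM0 (hq0 k)
  have hN : Tendsto N atTop atTop :=
    tendsto_atTop_mono (fun k => Nat.le_mul_of_pos_left _ hM0) hq
  have happ : ∀ i, ∃ C : ℝ, 0 ≤ C ∧ ∀ k, ∃ p : ℤ, |N k * (γ i * δ) - p| ≤ C / N k := by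
    intro i
    obtain ⟨a, b, hab⟩ : ∃ a b : ℤ, (M.natAbs : ℝ) * (γ i * δ) = a + b * α := by
      obtain ⟨a, b, hab⟩ := hα i
      rw [Nat.cast_natAbs, Int.cast_abs]
      rcases abs_choice (M : ℝ) with h | h <;> rw [h]
      · exact ⟨a, b, hab⟩
      · exact ⟨-a, -b, by push_cast; linarith⟩
    refine ⟨|(b : ℝ)| * M.natAbs, by positivity, fun k => ?_⟩
    obtain ⟨p, hp⟩ := hqα k
    refine ⟨a * q k + b * p, ?_⟩
    have e : N k * (γ i * δ) - ((a * q k + b * p : ℤ) : ℝ) = b * (q k * α - p) := by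
      simp only [hNdef]
      push_cast
      linear_combination (q k : ℝ) * hab
    rw [e, abs_mul]
    have h1 : (0 : ℝ) < M.natAbs := by exact_mod_cast hM0
    have h2 : (0 : ℝ) < q k := by exact_mod_cast hq0 k
    calc |(b : ℝ)| * |q k * α - p| ≤ |(b : ℝ)| * (1 / q k) := by gcongr
      _ = |(b : ℝ)| * M.natAbs / N k := by simp only [hNdef]; push_cast; field_simp
  refine false_of_shift_relations hγ hg hg0 hrel hδ hδ0 hN (fun i => ?_) ?_
  · obtain ⟨C, -, hC⟩ := happ i
    exact tendsto_expi_of_approx hN hC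
  · intro p hp hexp
    obtain ⟨s, hs, hint⟩ := hex p hp hexp
    obtain ⟨γ₀, hγ₀, hγ₀0, hgen⟩ := exists_generator_of_integral_multiples _ hδ hδ0 hs
    obtain ⟨P, hP, hnorm⟩ := exists_polynomial_norm_trigEval hγ hp.ne_zero (γ₀ := γ₀)
      fun n hn m hm => hgen _ (Submodule.sub_mem _ (freq_mem_span n) (freq_mem_span m))
        (hint n hn m hm)
    obtain ⟨C, hC0, hC⟩ := exists_approx_of_mem_span happ hγ₀
    simp only [hnorm]
    exact tightFactor_norm_polynomial_eval hγ₀0 hN0 hC0 hC hP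

/-- In a compact group the powers of any element accumulate at the identity. -/
lemma exists_recurrence_times (v : ι → ℝ) :
    ∃ N : ℕ → ℕ, Tendsto N atTop atTop ∧ ∀ i, Tendsto (fun k => expi (N k * v i)) atTop (𝓝 1) := by
  let z : ι → Circle := fun i => Circle.exp (2 * Real.pi * v i)
  obtain ⟨N, hN, hlim⟩ := (mapClusterPt_one_atTop_pow z).tendsto_subseq
  refine ⟨N, hN.tendsto_atTop, fun i => ?_⟩
  have h := ((by fun_prop : Continuous fun w : Circle => (w : ℂ)).tendsto _).comp ((tendsto_pi_nhds.mp hlim) i)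
  have e : (((1 : ι → Circle) i : Circle) : ℂ) = 1 := by simp
  rw [e] at h
  refine h.congr fun k => ?_
  rw [expi_nat_mul]
  simp [z, Circle.coe_exp, expi]

/-- The nonresonant case: no prime but a monomial is exceptional. -/
theorem false_of_nonresonant (hγ : LinearIndependent ℤ γ) {g : ℝ → ℂ}
    (hg : MemLp g 2 volume) (hg0 : ¬ g =ᵐ[volume] 0)
    (hrel : ∀ δ ∈ Submodule.span ℤ (Set.range γ), ∃ A B : MvPolynomial ι ℂ, A ≠ 0 ∧ B ≠ 0 ∧
      ∀ᵐ x, trigEval γ x B * g (x + δ) = trigEval γ x A * g x)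
    {δ : ℝ} (hδ : δ ∈ Submodule.span ℤ (Set.range γ)) (hδ0 : δ ≠ 0)
    (hex : ∀ p, Prime p → Exceptional γ δ p →
      ∀ n ∈ p.support, ∀ m ∈ p.support, freq γ n = freq γ m) : False := by
  obtain ⟨N, hN, hN1⟩ := exists_recurrence_times fun i => γ i * δ
  refine false_of_shift_relations hγ hg hg0 hrel hδ hδ0 hN (fun i => ?_) fun p hp hexp => ?_
  · simpa only [mul_left_comm (γ i)] using hN1 i
  · obtain ⟨P, hP, hnorm⟩ := exists_polynomial_norm_trigEval hγ hp.ne_zero (γ₀ := 0)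
      fun n hn m hm => ⟨0, by rw [hex p hp hexp n hn m hm]; simp⟩
    have hne : ‖P.eval (expi (0 * 0))‖ ≠ 0 := by
      obtain ⟨x, hx⟩ := exists_trigEval_ne_zero hγ hp.ne_zero
      have := hnorm x
      rw [zero_mul] at this ⊢
      rw [← this]
      exact norm_ne_zero_iff.mpr hx
    simpa only [hnorm, zero_mul] using tightFactor_const δ N hne

end Arithmetic

/-! ### Case distinction by rank and conclusion -/

section FinalArgument

open MvPolynomial

lemma false_of_rank_one {γ : Fin 1 → ℝ} (hγ : LinearIndependent ℤ γ) {g : ℝ → ℂ}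
    (hg : MemLp g 2 volume) (hg0 : ¬ g =ᵐ[volume] 0)
    (hrel : ∀ δ ∈ Submodule.span ℤ (Set.range γ), ∃ A B : MvPolynomial (Fin 1) ℂ, A ≠ 0 ∧ B ≠ 0 ∧
      ∀ᵐ x, trigEval γ x B * g (x + δ) = trigEval γ x A * g x) : False := by
  have h0 : γ 0 ≠ 0 := hγ.ne_zero 0
  -- Here Δ = ℤγ₀: all frequencies are multiples of γ₀, so s = γ₀⁻¹ works for every prime,
  -- exceptional or not.
  refine false_of_resonant hγ hg hg0 hrel (Submodule.subset_span (Set.mem_range_self 0)) h0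
    (α := γ 0 * γ 0) (M := 1) one_ne_zero (fun i => ⟨0, 1, ?_⟩) fun p _ _ =>
    ⟨(γ 0)⁻¹, inv_ne_zero h0, fun n _ m _ => ⟨n 0 - m 0, ?_⟩⟩
  · rw [Subsingleton.elim i 0]; simp
  · simp only [freq, Fin.sum_univ_one]
    push_cast
    field_simp

lemma false_of_rank_two {γ : Fin 2 → ℝ} (hγ : LinearIndependent ℤ γ) {g : ℝ → ℂ}
    (hg : MemLp g 2 volume) (hg0 : ¬ g =ᵐ[volume] 0)
    (hrel : ∀ δ ∈ Submodule.span ℤ (Set.range γ), ∃ A B : MvPolynomial (Fin 2) ℂ, A ≠ 0 ∧ B ≠ 0 ∧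
      ∀ᵐ x, trigEval γ x B * g (x + δ) = trigEval γ x A * g x) : False := by
  have hmem : ∀ i, γ i ∈ Submodule.span ℤ (Set.range γ) := fun i =>
    Submodule.subset_span (Set.mem_range_self i)
  have hind : ∀ a b : ℤ, a * γ 0 + b * γ 1 = 0 → a = 0 ∧ b = 0 := by
    intro a b h
    have := Fintype.linearIndependent_iff.mp hγ ![a, b] (by simpa [Fin.sum_univ_two] using h)
    exact ⟨this 0, this 1⟩
  have hspan : ∀ β ∈ Submodule.span ℤ (Set.range γ), ∃ a b : ℤ, β = a * γ 0 + b * γ 1 := by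
    intro β hβ
    obtain ⟨c, hc⟩ := (Submodule.mem_span_range_iff_exists_fun ℤ).mp hβ
    exact ⟨c 0, c 1, by rw [← hc]; simp [Fin.sum_univ_two]⟩
  by_cases hres : ∃ β ∈ Submodule.span ℤ (Set.range γ), ∃ δ ∈ Submodule.span ℤ (Set.range γ),
      β ≠ 0 ∧ δ ≠ 0 ∧ ∃ z : ℤ, β * δ = z
  · obtain ⟨β, hβ, δ, hδ, hβ0, hδ0, z, hz⟩ := hres
    obtain ⟨a, b, hab⟩ := hspan δ hδ
    obtain ⟨c, d, hcd⟩ := hspan β hβ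
    -- Expanding βδ = z in the basis gives c γ₀δ + d γ₁δ = z, which expresses one product through
    -- the other after multiplication by a nonzero coefficient.
    obtain ⟨α, M, hM, hα⟩ : ∃ (α : ℝ) (M : ℤ), M ≠ 0 ∧
        ∀ i, ∃ u v : ℤ, M * (γ i * δ) = u + v * α := by
      by_cases hd : d = 0
      · refine ⟨γ 1 * δ, c, fun hc => hβ0 (by rw [hcd, hc, hd]; simp), fun i => ?_⟩
        fin_cases i
        · refine ⟨z, 0, ?_⟩
          rw [hcd, hd] at hz
          simp only [Fin.zero_eta]
          push_cast at hz ⊢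
          linarith
        · exact ⟨0, c, by simp⟩
      · refine ⟨γ 0 * δ, d, hd, fun i => ?_⟩
        fin_cases i
        · exact ⟨0, d, by simp⟩
        · refine ⟨z, -c, ?_⟩
          rw [hcd] at hz
          simp only [Fin.mk_one]
          push_cast
          linarith
    -- Some basis element is independent of δ; for it, the shift mδ₂ + kδ fixing an exceptional
    -- prime is nonzero.
    obtain ⟨δ₂, hδ₂, hind₂⟩ : ∃ δ₂ ∈ Submodule.span ℤ (Set.range γ),
        ∀ m k : ℤ, m * δ₂ + k * δ = 0 → m = 0 := by
      by_cases hb : b = 0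
      · have ha : a ≠ 0 := fun ha => hδ0 (by rw [hab, ha, hb]; simp)
        refine ⟨γ 1, hmem 1, fun m k h => (hind (k * a) m ?_).2⟩
        rw [hab, hb] at h
        push_cast at h ⊢
        linarith
      · refine ⟨γ 0, hmem 0, fun m k h => ?_⟩
        have h2 := hind (m + k * a) (k * b) (by rw [hab] at h; push_cast; linarith)
        have hk : k = 0 := (mul_eq_zero.mp h2.2).resolve_right hb
        simpa [hk] using h2.1
    refine false_of_resonant hγ hg hg0 hrel hδ hδ0 hM hα fun p _ hp => ?_
    obtain ⟨m, hm, k, hass⟩ := hp δ₂ hδ₂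
    exact ⟨_, fun h => hm (hind₂ m k h), fun n hn n' hn' =>
      exists_eq_int_of_associated_shift γ hass hn hn'⟩
  · refine false_of_nonresonant hγ hg hg0 hrel (hmem 0) (hγ.ne_zero 0)
      fun p _ hp n hn n' hn' => ?_
    obtain ⟨m, hm, k, hass⟩ := hp (γ 1) (hmem 1)
    obtain ⟨z, hz⟩ := exists_eq_int_of_associated_shift γ hass hn hn'
    by_contra hne
    -- Two distinct frequencies in an exceptional prime would themselves produce a resonance.
    refine hres ⟨_, Submodule.sub_mem _ (freq_mem_span n) (freq_mem_span n'), _,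
      Submodule.add_mem _ (Submodule.smul_mem _ m (hmem 1)) (Submodule.smul_mem _ k (hmem 0)),
      sub_ne_zero.mpr hne, ?_, z, ?_⟩
    · intro h0
      refine hm (hind k m ?_).2
      simp only [zsmul_eq_mul] at h0
      linarith
    · simpa only [zsmul_eq_mul] using hz

lemma false_of_rank_ge_three {r : ℕ} (hr : 3 ≤ r) {γ : Fin r → ℝ} (hγ : LinearIndependent ℤ γ)
    {g : ℝ → ℂ} (hg : MemLp g 2 volume) (hg0 : ¬ g =ᵐ[volume] 0)
    (hrel : ∀ δ ∈ Submodule.span ℤ (Set.range γ), ∃ A B : MvPolynomial (Fin r) ℂ, A ≠ 0 ∧ B ≠ 0 ∧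
      ∀ᵐ x, trigEval γ x B * g (x + δ) = trigEval γ x A * g x) : False := by
  have hmem : ∀ i, γ i ∈ Submodule.span ℤ (Set.range γ) := fun i =>
    Submodule.subset_span (Set.mem_range_self i)
  have h3 := hγ.comp _ (Fin.castLE_injective hr)
  set v := γ ∘ Fin.castLE hr with hv
  have hvmem : ∀ i, v i ∈ Submodule.span ℤ (Set.range γ) := fun i => hmem _
  have hind : ∀ a b c : ℤ, a * v 0 + b * v 1 + c * v 2 = 0 → a = 0 ∧ b = 0 ∧ c = 0 := by
    intro a b c h
    have := Fintype.linearIndependent_iff.mp h3 ![a, b, c] (by simpa [Fin.sum_univ_three] using h)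
    exact ⟨this 0, this 1, this 2⟩
  refine false_of_nonresonant hγ hg hg0 hrel (hvmem 0) (h3.ne_zero 0) fun p _ hp n hn n' hn' => ?_
  obtain ⟨m, hm, k, hass⟩ := hp (v 1) (hvmem 1)
  obtain ⟨m', hm', k', hass'⟩ := hp (v 2) (hvmem 2)
  obtain ⟨z, hz⟩ := exists_eq_int_of_associated_shift γ hass hn hn'
  obtain ⟨z', hz'⟩ := exists_eq_int_of_associated_shift γ hass' hn hn'
  by_contra hne
  have hd : freq γ n - freq γ n' ≠ 0 := sub_ne_zero.mpr hne
  -- A nonzero frequency difference d would satisfy d(mv₁ + kv₀) = z and d(m'v₂ + k'v₀) = z'.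
  -- Eliminating d gives an integral relation among v₀, v₁, v₂; independence forces z' = 0 and then
  -- m' = 0.
  have hcomb : (z' : ℝ) * (m * v 1 + k * v 0) - z * (m' * v 2 + k' * v 0) = 0 := by
    refine (mul_eq_zero.mp (?_ : (freq γ n - freq γ n') * _ = 0)).resolve_left hd
    linear_combination (z' : ℝ) * hz - z * hz'
  obtain ⟨-, hzm, -⟩ := hind (z' * k - z * k') (z' * m) (-(z * m')) (by push_cast; linarith)
  have hz'0 : z' = 0 := (mul_eq_zero.mp hzm).resolve_right hm
  rw [hz'0, Int.cast_zero] at hz'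
  have h0 := (mul_eq_zero.mp hz').resolve_left hd
  exact hm' (hind k' 0 m' (by push_cast; linarith)).2.2

theorem false_of_trigonometric_relations {r : ℕ} (hr : r ≠ 0) {γ : Fin r → ℝ}
    (hγ : LinearIndependent ℤ γ) {g : ℝ → ℂ} (hg : MemLp g 2 volume) (hg0 : ¬ g =ᵐ[volume] 0)
    (hrel : ∀ δ ∈ Submodule.span ℤ (Set.range γ), ∃ A B : MvPolynomial (Fin r) ℂ, A ≠ 0 ∧ B ≠ 0 ∧
      ∀ᵐ x, trigEval γ x B * g (x + δ) = trigEval γ x A * g x) : False := by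
  match r with
  | 0 => exact hr rfl
  | 1 => exact false_of_rank_one hγ hg hg0 hrel
  | 2 => exact false_of_rank_two hγ hg hg0 hrel
  | r + 3 => exact false_of_rank_ge_three (by omega) hγ hg hg0 hrel

variable {ι : Type*} {γ : ι → ℝ}

/-- The shifts of `g` that are quotients of trigonometric polynomials times `g` form a group. -/
lemma exists_relation_of_mem_span {g : ℝ → ℂ} {S : Set ℝ}
    (hS : ∀ δ ∈ S, ∃ A B : MvPolynomial ι ℂ, A ≠ 0 ∧ B ≠ 0 ∧
      ∀ᵐ x, trigEval γ x B * g (x + δ) = trigEval γ x A * g x) {δ : ℝ}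
    (hδ : δ ∈ AddSubgroup.closure S) : ∃ A B : MvPolynomial ι ℂ, A ≠ 0 ∧ B ≠ 0 ∧
      ∀ᵐ x, trigEval γ x B * g (x + δ) = trigEval γ x A * g x := by
  induction hδ using AddSubgroup.closure_induction with
  | mem x hx => exact hS x hx
  | zero => exact ⟨1, 1, one_ne_zero, one_ne_zero, by simp⟩
  | add s t _ _ hs ht =>
    obtain ⟨A, B, hA, hB, h⟩ := hs
    obtain ⟨A', B', hA', hB', h'⟩ := ht
    refine ⟨shiftHom γ s A' * A, shiftHom γ s B' * B, mul_ne_zero (shiftHom_ne_zero γ s hA') hA,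
      mul_ne_zero (shiftHom_ne_zero γ s hB') hB, ?_⟩
    filter_upwards [h, ae_comp_add h' s] with x h1 h2
    rw [add_assoc] at h2
    simp only [map_mul, trigEval_shiftHom]
    linear_combination trigEval γ x B * h2 + trigEval γ (x + s) A' * h1
  | neg s _ hs =>
    obtain ⟨A, B, hA, hB, h⟩ := hs
    refine ⟨shiftHom γ (-s) B, shiftHom γ (-s) A, shiftHom_ne_zero γ _ hB,
      shiftHom_ne_zero γ _ hA, ?_⟩
    filter_upwards [ae_comp_add h (-s)] with x h1
    rw [neg_add_cancel_right] at h1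
    simp only [trigEval_shiftHom]
    exact h1.symm

/-- A large common shift τ makes all exponents nonnegative, so polynomials suffice instead of
Laurent polynomials; the character of τ cancels in the relations. -/
lemma exists_common_monomials [Fintype ι] (A : Finset ℝ) (a₀ : ℝ)
    (hA : ∀ a ∈ A, a - a₀ ∈ Submodule.span ℤ (Set.range γ)) :
    ∃ (τ : ℝ) (n : ℝ → ι →₀ ℕ), ∀ a ∈ A, -a = τ + freq γ (n a) := by
  have h1 : ∀ a ∈ A, ∃ c : ι → ℤ, ∑ i, c i • γ i = a - a₀ := fun a ha =>
    (Submodule.mem_span_range_iff_exists_fun ℤ).mp (hA a ha)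
  choose! c hc using h1
  obtain ⟨M, hM⟩ : ∃ M : ℕ, ∀ a ∈ A, ∀ i, (c a i).natAbs ≤ M :=
    ⟨A.sup fun a => Finset.univ.sup fun i => (c a i).natAbs, fun a ha i =>
      (Finset.le_sup (f := fun i => (c a i).natAbs) (Finset.mem_univ i)).trans
        (Finset.le_sup (f := fun a => Finset.univ.sup fun i => (c a i).natAbs) ha)⟩
  refine ⟨-a₀ - ∑ i, M * γ i, fun a => Finsupp.equivFunOnFinite.symm fun i => (M - c a i).toNat,
    fun a ha => ?_⟩
  have h2 : ∀ i, (((M - c a i).toNat : ℕ) : ℝ) = M - c a i := by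
    intro i
    have h3 : (((M - c a i).toNat : ℤ) : ℝ) = ((M - c a i : ℤ) : ℝ) := by
      rw [Int.toNat_of_nonneg]
      have := hM a ha i
      omega
    rw [Int.cast_natCast] at h3
    rw [h3]
    push_cast
    rfl
  have h4 := hc a ha
  simp only [zsmul_eq_mul] at h4
  simp only [freq, Finsupp.equivFunOnFinite_symm_apply_apply, h2, sub_mul, Finset.sum_sub_distrib, h4]
  ring

theorem false_of_translate_relations {g H : ℝ → ℂ} {A : Finset ℝ} {c : ℝ → ℝ → ℂ}
    (hg : MemLp g 2 volume) (hg0 : ¬ g =ᵐ[volume] 0) (hA : ∃ a ∈ A, ∃ b ∈ A, a ≠ b)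
    (h : ∀ a ∈ A, ∀ᵐ x, g (x - a) = (∑ k ∈ A, c a k * expi (-k * x)) * H x) : False := by
  classical
  set S : Set ℝ := (fun q : ℝ × ℝ => q.1 - q.2) '' (A ×ˢ A : Finset (ℝ × ℝ)) with hS
  have hSfin : S.Finite := (Finset.finite_toSet _).image _
  have hSmem : ∀ a ∈ A, ∀ b ∈ A, a - b ∈ S := fun a ha b hb =>
    ⟨(a, b), by simpa using ⟨ha, hb⟩, rfl⟩
  set Δ : Submodule ℤ ℝ := Submodule.span ℤ S with hΔ
  have : Module.Finite ℤ Δ := Module.Finite.span_of_finite ℤ hSfin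
  have : Module.Free ℤ Δ := inferInstance
  let b := Module.finBasis ℤ Δ
  set γ : Fin (Module.finrank ℤ Δ) → ℝ := fun i => (b i : ℝ) with hγdef
  have hγ : LinearIndependent ℤ γ :=
    b.linearIndependent.map' Δ.subtype (Submodule.ker_subtype Δ)
  have hspan : Submodule.span ℤ (Set.range γ) = Δ := by
    have : Set.range γ = Δ.subtype '' Set.range b := by rw [← Set.range_comp]; rfl
    rw [this, Submodule.span_image, b.span_eq, Submodule.map_top, Submodule.range_subtype]
  have hr : Module.finrank ℤ Δ ≠ 0 := by
    intro h0
    obtain ⟨a, ha, a', ha', hne⟩ := hA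
    have hmem : a - a' ∈ Submodule.span ℤ (Set.range γ) := by
      rw [hspan]; exact Submodule.subset_span (hSmem a ha a' ha')
    have : IsEmpty (Fin (Module.finrank ℤ Δ)) := by rw [h0]; infer_instance
    rw [Set.range_eq_empty, Submodule.span_empty, Submodule.mem_bot] at hmem
    exact hne (sub_eq_zero.mp hmem)
  obtain ⟨a₀, ha₀, -⟩ := hA
  obtain ⟨τ, n, hn⟩ := exists_common_monomials (γ := γ) A a₀ fun a ha => by
    rw [hspan]; exact Submodule.subset_span (hSmem a ha a₀ ha₀)
  let P : ℝ → MvPolynomial (Fin (Module.finrank ℤ Δ)) ℂ := fun a =>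
    ∑ k ∈ A, monomial (n k) (c a k)
  have hP : ∀ a ∈ A, ∀ᵐ x, g (x - a) = expi (τ * x) * trigEval γ x (P a) * H x := by
    intro a ha
    filter_upwards [h a ha] with x hx
    rw [hx]
    congr 1
    simp only [P, map_sum, trigEval_monomial, Finset.mul_sum]
    refine Finset.sum_congr rfl fun k hk => ?_
    rw [hn k hk, add_mul, expi_add]
    ring
  have hP0 : ∀ a ∈ A, P a ≠ 0 := by
    intro a ha h0
    refine hg0 ?_
    filter_upwards [ae_comp_add (hP a ha) a] with x hx
    rw [h0] at hx
    simpa using hx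
  refine false_of_trigonometric_relations hr hγ hg hg0 fun δ hδ => ?_
  rw [hspan, hΔ, ← Submodule.mem_toAddSubgroup, Submodule.span_int_eq_addSubgroupClosure] at hδ
  refine exists_relation_of_mem_span ?_ hδ
  rintro _ ⟨⟨a, a'⟩, haa, rfl⟩
  obtain ⟨ha, ha'⟩ : a ∈ A ∧ a' ∈ A := by simpa using haa
  -- At x + a the expressions for g(x) and g(x + a - a') share the character and the value of H;
  -- cross-multiplying eliminates both.
  refine ⟨shiftHom γ a (P a'), shiftHom γ a (P a), shiftHom_ne_zero γ a (hP0 a' ha'),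
    shiftHom_ne_zero γ a (hP0 a ha), ?_⟩
  filter_upwards [ae_comp_add (hP a ha) a, ae_comp_add (hP a' ha') a] with x h1 h2
  rw [add_sub_cancel_right] at h1
  simp only [trigEval_shiftHom]
  rw [← add_sub_assoc, h1, h2]
  ring

end FinalArgument

theorem mainTheorem5 (M : Submodule ℂ L2R) [FiniteDimensional ℂ M]
    (hdim : 2 ≤ Module.finrank ℂ M) (hdim5 : Module.finrank ℂ M ≠ 5)
    (hM : ClosedUnderFourier M) :
    ¬ AdmitsCompleteTranslates M := by
  intro h
  obtain ⟨g, H, A, c, hg, hg0, hA, hrel⟩ := exists_translate_relations hdim hM h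
  exact false_of_translate_relations hg hg0 hA hrel
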